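/- Let $V$ be a vertex operator algebra over $\mathbb{C}$ and let $\mathcal{W}$ be the category of weak $V$-modules. Let $\mathcal{C}$ be a full subcategory of $\mathcal{W}$ whose objects are finitely generated grading-restricted generalized $V$-modules, which contains $0$ and is closed under submodules, quotients and finite direct sums (and isomorphisms). Suppose that $\mathcal{C}$ carries a $\mathbb{C}$-linear braided tensor category structure $(\boxtimes, V, l, r, \mathcal{A}, \mathcal{R})$ (so $V\in\mathcal{C}$, and $\boxtimes$ is bilinear on morphisms) with unit object $V$, and a twist $\theta$, that is, a natural automorphism of $\mathrm{Id}_{\mathcal{C}}$ with $\theta_V=\mathrm{Id}_V$ and $\theta_{W_1\boxtimes W_2}=\mathcal{R}_{W_2,W_1}\circ\mathcal{R}_{W_1,W_2}\circ(\theta_{W_1}\boxtimes\theta_{W_2})$. Let $\mathrm{Ind}(\mathcal{C})\subseteq\mathcal{W}$ be the full subcategory of weak modules isomorphic to direct limits in $\mathcal{W}$ of direct systems $I\to\mathcal{C}$ over directed sets $I$. For a weak module $X$ let $I_X$ be the directed set of submodules of $X$ which are objects of $\mathcal{C}$; write $i_W: W\to X$ for the inclusion of $W\in I_X$ and $\alpha_X: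 I_X\to\mathcal{C}$ for the corresponding direct system. Equip $\mathrm{Ind}(\mathcal{C})$ with the following $\mathbb{C}$-linear braided tensor category structure $(\widehat{\boxtimes},V,\mathfrak{l},\mathfrak{r},\mathfrak{A},\widehat{\mathcal{R}})$ and twist $\Theta$: * $X_1\widehat{\boxtimes}X_2=\varinjlim\alpha_{X_1}\boxtimes\alpha_{X_2}$, the direct limit of $W_1\boxtimes W_2$ over $(W_1,W_2)\in I_{X_1}\times I_{X_2}$, with canonical morphisms $\phi_{W_1,W_2}$; and $(F_1\widehat{\boxtimes}F_2)\circ\phi_{W_1,W_2}=\phi_{F_1(W_1),F_2(W_2)}\circ(F_1|_{W_1}\boxtimes F_2|_{W_2})$; * $\mathfrak{l}_X\circ\phi_{U,W}=i_W\circ l_W\circ(i_U\boxtimes\mathrm{Id}_W)$ and $\mathfrak{r}_X\circ\phi_{W,U}=i_W\circ r_W\circ(\mathrm{Id}_W\boxtimes i_U)$ for $U\in I_V$, $W\in I_X$; * $\mathfrak{A}_{X_1,X_2,X_3}: X_1\widehat{\boxtimes}(X_2\widehat{\boxtimes}X_3)\to(X_1\widehat{\boxtimes}X_2)\widehat{\boxtimes}X_3$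 is the isomorphism induced by $\mathcal{A}$ on $\varinjlim\alpha_{X_1}\boxtimes(\alpha_{X_2}\boxtimes\alpha_{X_3})\to\varinjlim(\alpha_{X_1}\boxtimes\alpha_{X_2})\boxtimes\alpha_{X_3}$, conjugated by the canonical isomorphisms of these two limits with the iterated tensor products; * $\widehat{\mathcal{R}}_{X_1,X_2}\circ\phi_{W_1,W_2}=\phi_{W_2,W_1}\circ\mathcal{R}_{W_1,W_2}$; * $\Theta_X$ is the automorphism of $X\cong\varinjlim\alpha_X$ induced by the $\theta_W$, $W\in I_X$, so that $\Theta_X\circ i_W=i_W\circ\theta_W$. Then the embedding $\mathcal{C}\to\mathrm{Ind}(\mathcal{C})$ is a braided tensor functor. More precisely, there are isomorphisms $Q_{W_1,W_2}: W_1\widehat{\boxtimes}W_2\to W_1\boxtimes W_2$ for $W_1,W_2\in\mathcal{C}$ such that $Q_{W_1,W_2}\circ\phi_{U_1,U_2}=i_{U_1}\boxtimes i_{U_2}$ for all $U_1\in I_{W_1}$, $U_2\in I_{W_2}$; they are natural in $W_1$ and $W_2$; and, together with the identity of the unit object $V$, they make the fully faithful $\mathbb{C}$-linear embedding a braided tensor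 functor, that is, $$\mathfrak{l}_W=l_W\circ Q_{V,W},\qquad \mathfrak{r}_W=r_W\circ Q_{W,V},\qquad Q_{W_2,W_1}\circ\widehat{\mathcal{R}}_{W_1,W_2}=\mathcal{R}_{W_1,W_2}\circ Q_{W_1,W_2},$$ $$Q_{W_1\boxtimes W_2,W_3}\circ(Q_{W_1,W_2}\widehat{\boxtimes}\mathrm{Id}_{W_3})\circ\mathfrak{A}_{W_1,W_2,W_3}=\mathcal{A}_{W_1,W_2,W_3}\circ Q_{W_1,W_2\boxtimes W_3}\circ(\mathrm{Id}_{W_1}\widehat{\boxtimes}Q_{W_2,W_3}).$$ Moreover $\Theta_W=\theta_W$ for $W$ in $\mathcal{C}$. Consequently the objects of $\mathcal{C}$ form a full monoidal subcategory of $\mathrm{Ind}(\mathcal{C})$, and the restriction to it of the structure $(\widehat{\boxtimes},V,\mathfrak{l},\mathfrak{r},\mathfrak{A},\widehat{\mathcal{R}},\Theta)$ is equivalent to $(\mathcal{C},\boxtimes,V,l,r,\mathcal{A},\mathcal{R},\theta)$: the functor induced by the embedding, with the isomorphisms $Q$ and $\mathrm{Id}_V$, is a $\mathbb{C}$-linear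 braided monoidal equivalence which preserves the twists. -/

import Mathlib

open CategoryTheory MonoidalCategory Limits

universe u

noncomputable section

namespace VOA

/-- The Jacobi identity
`x₀⁻¹δ((x₁-x₂)/x₀) Y_W(a,x₁)Y_W(b,x₂) - x₀⁻¹δ((x₂-x₁)/(-x₀)) Y_W(b,x₂)Y_W(a,x₁)
  = x₂⁻¹δ((x₁-x₀)/x₂) Y_W(Y(a,x₀)b,x₂)`
applied to a vector `w`, written out as the equality of the coefficients of
`x₀^(-l-1) x₁^(-m-1) x₂^(-n-1)`. Here `Y n a b` is the mode `a_n b`, that is,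
`Y(a,x)b = ∑ₙ a_n b x^(-n-1)`, and similarly for `YW`. All sums are finite as soon as
`Y` and `YW` satisfy lower truncation. -/
def JacobiIdentity {V W : Type u} [AddCommGroup V] [Module ℂ V] [AddCommGroup W] [Module ℂ W]
    (Y : ℤ → V →ₗ[ℂ] V →ₗ[ℂ] V) (YW : ℤ → V →ₗ[ℂ] W →ₗ[ℂ] W) (w : W) : Prop :=
  ∀ (a b : V) (l m n : ℤ),
    ∑ᶠ i : ℕ, ((-1 : ℤ) ^ i * Ring.choose l i) •
        (YW (m + l - i) a (YW (n + i) b w)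
          - (l.negOnePow : ℤ) • YW (n + l - i) b (YW (m + i) a w))
      = ∑ᶠ i : ℕ, Ring.choose m i • YW (m + n - i) (Y (l + i) a b) w

/-- Vertex operator algebras. -/
class VertexOperatorAlgebra (V : Type u) [AddCommGroup V] [Module ℂ V] where
  /-- `Y n a b` is the mode `a_n b`, so that `Y(a,x)b = ∑ₙ a_n b x^(-n-1)`. -/
  Y : ℤ → V →ₗ[ℂ] V →ₗ[ℂ] V
  /-- the vacuum vector -/
  vac : V
  /-- the conformal vector -/
  conf : V
  /-- the central charge -/
  centralCharge : ℂ
  /-- the conformal weight spaces `V_(n)` -/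
  weightSpace : ℤ → Submodule ℂ V
  grading : DirectSum.IsInternal weightSpace
  weightSpace_finite : ∀ n, FiniteDimensional ℂ (weightSpace n)
  weightSpace_lower : ∃ N : ℤ, ∀ n < N, weightSpace n = ⊥
  vac_mem : vac ∈ weightSpace 0
  conf_mem : conf ∈ weightSpace 2
  truncation : ∀ a b : V, ∃ N : ℤ, ∀ n ≥ N, Y n a b = 0
  vacuum : ∀ (n : ℤ) (a : V), Y n vac a = if n = -1 then a else 0
  creation : ∀ (a : V) (n : ℤ), 0 ≤ n → Y n a vac = 0
  creation_neg_one : ∀ a : V, Y (-1) a vac = a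
  jacobi : ∀ b : V, JacobiIdentity Y Y b
  /-- The Virasoro relations for `L(n) = conf_{n+1}`. -/
  virasoro : ∀ (m n : ℤ) (a : V),
    Y (m + 1) conf (Y (n + 1) conf a) - Y (n + 1) conf (Y (m + 1) conf a)
      = ((m - n : ℤ) : ℂ) • Y (m + n + 1) conf a
        + (if m + n = 0 then ((m : ℂ) ^ 3 - m) / 12 * centralCharge else 0) • a
  /-- `L(0)` acts on `V_(n)` as multiplication by `n`. -/
  weight : ∀ (n : ℤ), ∀ a ∈ weightSpace n, Y 1 conf a = (n : ℂ) • a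
  /-- The `L(-1)`-derivative property `Y(L(-1)a,x) = d/dx Y(a,x)`. -/
  derivative : ∀ (n : ℤ) (a b : V), Y n (Y 0 conf a) b = -(n : ℂ) • Y (n - 1) a b

variable (V : Type u) [AddCommGroup V] [Module ℂ V] [VertexOperatorAlgebra V]

open VertexOperatorAlgebra (Y vac conf)

/-- Weak modules for a vertex operator algebra `V`. -/
structure WeakModule where
  carrier : Type u
  [addCommGroup : AddCommGroup carrier]
  [module : Module ℂ carrier]
  /-- `mode n a w` is `a_n w`, so that `Y_W(a,x)w = ∑ₙ a_n w x^(-n-1)`. -/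
  mode : ℤ → V →ₗ[ℂ] carrier →ₗ[ℂ] carrier
  truncation : ∀ (a : V) (w : carrier), ∃ N : ℤ, ∀ n ≥ N, mode n a w = 0
  vacuum : ∀ (n : ℤ) (w : carrier), mode n vac w = if n = -1 then w else 0
  jacobi : ∀ w : carrier, JacobiIdentity Y mode w
  /-- The `L(-1)`-derivative property `Y_W(L(-1)a,x) = d/dx Y_W(a,x)`. -/
  derivative : ∀ (n : ℤ) (a : V) (w : carrier),
    mode n (Y 0 conf a) w = -(n : ℂ) • mode (n - 1) a w

namespace WeakModule

attribute [instance] WeakModule.addCommGroup WeakModule.module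

variable {V}

/-- Homomorphisms of weak `V`-modules: linear maps which commute with all modes. -/
@[ext]
structure Hom (W X : WeakModule V) where
  lin : W.carrier →ₗ[ℂ] X.carrier
  comm : ∀ (n : ℤ) (a : V) (w : W.carrier), lin (W.mode n a w) = X.mode n a (lin w)

instance : Category (WeakModule V) where
  Hom W X := Hom W X
  id W := ⟨LinearMap.id, fun _ _ _ => rfl⟩
  comp f g := ⟨g.lin ∘ₗ f.lin, fun n a w => by simp [f.comm, g.comm]⟩

/-- The underlying linear map of a morphism of weak `V`-modules. -/
def lin {W X : WeakModule V} (f : W ⟶ X) : W.carrier →ₗ[ℂ] X.carrier := Hom.lin f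

/-- The morphism with a given underlying linear map. -/
def ofLin {W X : WeakModule V} (f : W.carrier →ₗ[ℂ] X.carrier)
    (h : ∀ (n : ℤ) (a : V) (w : W.carrier), f (W.mode n a w) = X.mode n a (f w)) : W ⟶ X :=
  Hom.mk f h

@[simp] lemma lin_ofLin {W X : WeakModule V} (f : W.carrier →ₗ[ℂ] X.carrier) (h) :
    lin (ofLin f h) = f := rfl

lemma lin_mode {W X : WeakModule V} (f : W ⟶ X) (n : ℤ) (a : V) (w : W.carrier) :
    lin f (W.mode n a w) = X.mode n a (lin f w) := Hom.comm f n a w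

@[simp] lemma lin_id (W : WeakModule V) : lin (𝟙 W) = LinearMap.id := rfl

@[simp] lemma lin_comp {W X Z : WeakModule V} (f : W ⟶ X) (g : X ⟶ Z) :
    lin (f ≫ g) = lin g ∘ₗ lin f := rfl

lemma lin_injective {W X : WeakModule V} : Function.Injective (lin : (W ⟶ X) → _) :=
  fun _ _ h => Hom.ext h

lemma hom_ext {W X : WeakModule V} {f g : W ⟶ X} (h : ∀ w, lin f w = lin g w) : f = g :=
  lin_injective (LinearMap.ext h)

section Linear

variable {W X : WeakModule V}

instance : Zero (W ⟶ X) := ⟨ofLin 0 (by simp)⟩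
instance : Add (W ⟶ X) := ⟨fun f g => ofLin (lin f + lin g) (by simp [lin_mode])⟩
instance : Neg (W ⟶ X) := ⟨fun f => ofLin (-lin f) (by simp [lin_mode])⟩
instance : Sub (W ⟶ X) := ⟨fun f g => ofLin (lin f - lin g) (by simp [lin_mode])⟩
instance : SMul ℂ (W ⟶ X) := ⟨fun c f => ofLin (c • lin f) (by simp [lin_mode])⟩
instance : SMul ℕ (W ⟶ X) := ⟨fun c f => ofLin (c • lin f) (by simp [lin_mode])⟩
instance : SMul ℤ (W ⟶ X) := ⟨fun c f => ofLin (c • lin f) (by simp [lin_mode])⟩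

instance : AddCommGroup (W ⟶ X) :=
  lin_injective.addCommGroup lin rfl (fun _ _ => rfl) (fun _ => rfl) (fun _ _ => rfl)
    (fun _ _ => rfl) (fun _ _ => rfl)

/-- Taking underlying linear maps is additive. -/
def linHom : (W ⟶ X) →+ (W.carrier →ₗ[ℂ] X.carrier) where
  toFun := lin
  map_zero' := rfl
  map_add' _ _ := rfl

instance : Module ℂ (W ⟶ X) :=
  lin_injective.module ℂ linHom (fun _ _ => rfl)

@[simp] lemma lin_add (f g : W ⟶ X) : lin (f + g) = lin f + lin g := rfl
@[simp] lemma lin_smul (c : ℂ) (f : W ⟶ X) : lin (c • f) = c • lin f := rfl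

end Linear

instance : Preadditive (WeakModule V) where
  add_comp _ _ _ _ _ _ := hom_ext fun _ => by simp
  comp_add _ _ _ _ _ _ := hom_ext fun _ => by simp

instance : Linear ℂ (WeakModule V) where
  smul_comp _ _ _ _ _ _ := hom_ext fun _ => by simp
  comp_smul _ _ _ _ _ _ := hom_ext fun _ => by simp

end WeakModule

section Jacobi

variable {V}
variable {W X : Type u} [AddCommGroup W] [Module ℂ W] [AddCommGroup X] [Module ℂ X]
  {YW : ℤ → V →ₗ[ℂ] W →ₗ[ℂ] W} {YX : ℤ → V →ₗ[ℂ] X →ₗ[ℂ] X}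

/-- Linear maps which commute with modes transport both sides of the Jacobi identity. -/
lemma jacobi_aux (hW : ∀ (a : V) (w : W), ∃ N : ℤ, ∀ n ≥ N, YW n a w = 0)
    (f : W →ₗ[ℂ] X) (hf : ∀ (n : ℤ) (a : V) (w : W), f (YW n a w) = YX n a (f w)) 
    (w : W) (a b : V) (l m n : ℤ) :
    f (∑ᶠ i : ℕ, ((-1 : ℤ) ^ i * Ring.choose l i) •
        (YW (m + l - i) a (YW (n + i) b w)
          - (l.negOnePow : ℤ) • YW (n + l - i) b (YW (m + i) a w))) =
      ∑ᶠ i : ℕ, ((-1 : ℤ) ^ i * Ring.choose l i) •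
        (YX (m + l - i) a (YX (n + i) b (f w))
          - (l.negOnePow : ℤ) • YX (n + l - i) b (YX (m + i) a (f w))) ∧
    f (∑ᶠ i : ℕ, Ring.choose m i • YW (m + n - i) (Y (l + i) a b) w) =
      ∑ᶠ i : ℕ, Ring.choose m i • YX (m + n - i) (Y (l + i) a b) (f w) := by
  obtain ⟨N₁, h₁⟩ := hW b w
  obtain ⟨N₂, h₂⟩ := hW a w
  obtain ⟨N₃, h₃⟩ := VertexOperatorAlgebra.truncation a b
  constructor
  · have := AddMonoidHom.map_finsum (f := fun i : ℕ => ((-1 : ℤ) ^ i * Ring.choose l i) •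
        (YW (m + l - i) a (YW (n + i) b w)
          - (l.negOnePow : ℤ) • YW (n + l - i) b (YW (m + i) a w))) f.toAddMonoidHom ?_
    · refine this.trans (finsum_congr fun i => ?_)
      simp [hf]
    · refine (Set.finite_lt_nat ((N₁ - n).toNat + (N₂ - m).toNat)).subset fun i hi => ?_
      by_contra hlt
      simp only [Set.mem_ofPred_eq, not_lt] at hlt
      apply hi
      simp only
      rw [h₁ _ (by omega), h₂ _ (by omega)]
      simp
  · have := AddMonoidHom.map_finsum (f := fun i : ℕ => Ring.choose m i •
        YW (m + n - i) (Y (l + i) a b) w) f.toAddMonoidHom ?_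
    · refine this.trans (finsum_congr fun i => ?_)
      simp [hf]
    · refine (Set.finite_lt_nat ((N₃ - l).toNat)).subset fun i hi => ?_
      by_contra hlt
      simp only [Set.mem_ofPred_eq, not_lt] at hlt
      apply hi
      simp only
      rw [h₃ _ (by omega)]
      simp

lemma jacobi_map (hW : ∀ (a : V) (w : W), ∃ N : ℤ, ∀ n ≥ N, YW n a w = 0)
    (f : W →ₗ[ℂ] X) (hf : ∀ (n : ℤ) (a : V) (w : W), f (YW n a w) = YX n a (f w)) {w : W}
    (h : JacobiIdentity Y YW w) : JacobiIdentity Y YX (f w) := fun a b l m n => by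
  obtain ⟨h₁, h₂⟩ := jacobi_aux hW f hf w a b l m n
  rw [← h₁, ← h₂, h a b l m n]

lemma jacobi_comap {ι : Sort*} {X : ι → WeakModule V}
    (hW : ∀ (a : V) (w : W), ∃ N : ℤ, ∀ n ≥ N, YW n a w = 0)
    (f : ∀ i, W →ₗ[ℂ] (X i).carrier)
    (hf : ∀ i (n : ℤ) (a : V) (w : W), f i (YW n a w) = (X i).mode n a (f i w))
    (hinj : ∀ w w', (∀ i, f i w = f i w') → w = w') (w : W) :
    JacobiIdentity Y YW w := fun a b l m n => hinj _ _ fun i => by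
  obtain ⟨h₁, h₂⟩ := jacobi_aux hW (f i) (hf i) w a b l m n
  rw [h₁, h₂, (X i).jacobi (f i w) a b l m n]

end Jacobi

namespace WeakModule

/-- `V` as a module for itself. -/
def self : WeakModule V where
  carrier := V
  mode := Y
  truncation := VertexOperatorAlgebra.truncation
  vacuum := VertexOperatorAlgebra.vacuum
  jacobi := VertexOperatorAlgebra.jacobi
  derivative := VertexOperatorAlgebra.derivative

variable {V}

/-- The direct sum of two weak `V`-modules. -/
def prod (W X : WeakModule V) : WeakModule V where
  carrier := W.carrier × X.carrier
  mode n := LinearMap.mk₂ ℂ (fun a w => (W.mode n a w.1, X.mode n a w.2))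
    (by simp) (by simp) (by simp) (by simp)
  truncation a w := by
    obtain ⟨N₁, h₁⟩ := W.truncation a w.1
    obtain ⟨N₂, h₂⟩ := X.truncation a w.2
    refine ⟨max N₁ N₂, fun n hn => ?_⟩
    simp [h₁ n (le_trans (le_max_left _ _) hn), h₂ n (le_trans (le_max_right _ _) hn)]
  vacuum n w := by
    by_cases h : n = -1 <;> simp [W.vacuum, X.vacuum, h]
  jacobi := jacobi_comap (ι := Bool) (X := fun i => bif i then W else X)
    (by
      intro a w
      obtain ⟨N₁, h₁⟩ := W.truncation a w.1
      obtain ⟨N₂, h₂⟩ := X.truncation a w.2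
      refine ⟨max N₁ N₂, fun n hn => ?_⟩
      simp [h₁ n (le_trans (le_max_left _ _) hn), h₂ n (le_trans (le_max_right _ _) hn)])
    (fun i => match i with
      | true => LinearMap.fst ℂ _ _
      | false => LinearMap.snd ℂ _ _)
    (fun i => match i with
      | true => fun _ _ _ => rfl
      | false => fun _ _ _ => rfl)
    (fun _ _ h => Prod.ext (h true) (h false))
  derivative n a w := by
    simp [W.derivative, X.derivative]

end WeakModule

/-- Submodules of a weak `V`-module: subspaces which are closed under all modes. -/
@[ext]
structure WeakSubmodule {V : Type u} [AddCommGroup V] [Module ℂ V] [VertexOperatorAlgebra V]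
    (W : WeakModule V) extends Submodule ℂ W.carrier where
  mode_mem : ∀ (n : ℤ) (a : V) {w : W.carrier}, w ∈ toSubmodule → W.mode n a w ∈ toSubmodule

variable {V}

namespace WeakSubmodule

variable {W : WeakModule V}

lemma toSubmodule_injective :
    Function.Injective (toSubmodule : WeakSubmodule W → Submodule ℂ W.carrier) := by
  rintro ⟨N, _⟩ ⟨N', _⟩ h
  simpa using h

instance : PartialOrder (WeakSubmodule W) := PartialOrder.lift toSubmodule toSubmodule_injective

/-- A submodule as a weak module. -/
def toWeakModule (N : WeakSubmodule W) : WeakModule V where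
  carrier := N.toSubmodule
  mode n := LinearMap.mk₂ ℂ (fun a w => ⟨W.mode n a w, N.mode_mem n a w.2⟩)
    (fun _ _ _ => Subtype.ext (by simp)) (fun _ _ _ => Subtype.ext (by simp))
    (fun _ _ _ => Subtype.ext (by simp)) (fun _ _ _ => Subtype.ext (by simp))
  truncation a w := by
    obtain ⟨M, h⟩ := W.truncation a w
    exact ⟨M, fun n hn => Subtype.ext (h n hn)⟩
  vacuum n w := by
    by_cases h : n = -1 <;> exact Subtype.ext (by simp [W.vacuum, h])
  jacobi := jacobi_comap (ι := Unit) (X := fun _ => W)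
    (by
      intro a w
      obtain ⟨M, h⟩ := W.truncation a w
      exact ⟨M, fun n hn => Subtype.ext (h n hn)⟩)
    (fun _ => N.toSubmodule.subtype) (fun _ _ _ _ => rfl) (fun _ _ h => Subtype.ext (h ()))
  derivative n a w := Subtype.ext (by simp [W.derivative])

/-- The inclusion of a submodule. -/
def incl (N : WeakSubmodule W) : N.toWeakModule ⟶ W :=
  WeakModule.ofLin N.toSubmodule.subtype (fun _ _ _ => rfl)

/-- The inclusion of a submodule into a larger one. -/
def inclOfLE {N N' : WeakSubmodule W} (h : N ≤ N') : N.toWeakModule ⟶ N'.toWeakModule :=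
  WeakModule.ofLin (Submodule.inclusion h) (fun _ _ _ => rfl)

end WeakSubmodule

set_option linter.unusedSectionVars false

namespace WeakModule

/-- The generalized eigenspace `W_[h]` of `L(0)` with generalized eigenvalue `h`. -/
def genWeightSpace (W : WeakModule V) (h : ℂ) : Submodule ℂ W.carrier :=
  Module.End.maxGenEigenspace (W.mode 1 conf) h

/-- Grading-restricted generalized `V`-modules. -/
structure IsGradingRestrictedGeneralized (W : WeakModule V) : Prop where
  grading : DirectSum.IsInternal W.genWeightSpace
  finite : ∀ h : ℂ, FiniteDimensional ℂ (W.genWeightSpace h)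
  lower : ∀ h : ℂ, ∃ N : ℤ, ∀ n < N, W.genWeightSpace (h + n) = ⊥

/-- A weak module is finitely generated if some finite set of vectors is contained in no proper
submodule. -/
def IsFinitelyGenerated (W : WeakModule V) : Prop :=
  ∃ S : Finset W.carrier, ∀ N : WeakSubmodule W, (∀ w ∈ S, w ∈ N.toSubmodule) →
    ∀ w, w ∈ N.toSubmodule

end WeakModule

/-- The standing assumptions on a full subcategory `C` of grading-restricted generalized
`V`-modules, where `C` is given by the property `P` of being one of its objects: it contains `0`,
it is closed under submodules, quotients and finite direct sums, and its objects are finitely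
generated. -/
class IsModuleSubcategory (P : ObjectProperty (WeakModule V)) : Prop where
  gradingRestricted : ∀ W, P W → W.IsGradingRestrictedGeneralized
  zero : ∀ W : WeakModule V, Subsingleton W.carrier → P W
  submodule : ∀ {W X : WeakModule V} (f : W ⟶ X), Function.Injective (WeakModule.lin f) →
    P X → P W
  quotient : ∀ {W X : WeakModule V} (f : W ⟶ X), Function.Surjective (WeakModule.lin f) →
    P W → P X
  prod : ∀ W X : WeakModule V, P W → P X → P (W.prod X)
  finitelyGenerated : ∀ W, P W → W.IsFinitelyGenerated

/-! ### Direct limits of weak modules -/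

section DirLim

open WeakModule

variable {I : Type u} [Preorder I] [Nonempty I] [IsDirectedOrder I] (α : I ⥤ WeakModule V)

/-- The transition maps of a direct system. -/
abbrev trans (i j : I) (h : i ≤ j) : (α.obj i).carrier →ₗ[ℂ] (α.obj j).carrier :=
  lin (α.map (homOfLE h))

instance : DirectedSystem (fun i => (α.obj i).carrier) (fun i j h => trans α i j h) where
  map_self i x := by
    change lin (α.map (𝟙 i)) x = x
    simp
  map_map i j k hij hjk x := by
    change lin (α.map (homOfLE hjk)) (lin (α.map (homOfLE hij)) x) = _
    rw [← LinearMap.comp_apply, ← lin_comp, ← α.map_comp]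
    rfl

open Classical in
/-- The direct limit of the underlying vector spaces. -/
abbrev dirLimCarrier : Type u :=
  Module.DirectLimit (fun i => (α.obj i).carrier) (trans α)

open Classical in
/-- The canonical linear maps into the direct limit. -/
abbrev dirLimOf (i : I) : (α.obj i).carrier →ₗ[ℂ] dirLimCarrier α :=
  Module.DirectLimit.of ℂ I (fun i => (α.obj i).carrier) (trans α) i

open Classical in
/-- The modes on the direct limit, `a_n φ_i(w) = φ_i(a_n w)`. -/
def dirLimMode (n : ℤ) : V →ₗ[ℂ] dirLimCarrier α →ₗ[ℂ] dirLimCarrier α where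
  toFun a := Module.DirectLimit.map (fun i => (α.obj i).mode n a)
    (fun _ _ h => LinearMap.ext fun w => (lin_mode (α.map (homOfLE h)) n a w).symm)
  map_add' a b := by
    apply Module.DirectLimit.hom_ext
    intro i
    ext w
    simp
  map_smul' c a := by
    apply Module.DirectLimit.hom_ext
    intro i
    ext w
    simp

open Classical in
lemma dirLimMode_of (n : ℤ) (a : V) (i : I) (w : (α.obj i).carrier) :
    dirLimMode α n a (dirLimOf α i w) = dirLimOf α i ((α.obj i).mode n a w) :=
  Module.DirectLimit.map_apply_of (fun i => (α.obj i).mode n a)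
    (fun i j h => LinearMap.ext fun w => (lin_mode (α.map (homOfLE h)) n a w).symm) w

open Classical in
lemma exists_dirLimOf (z : dirLimCarrier α) : ∃ i w, dirLimOf α i w = z :=
  Module.DirectLimit.exists_of z

/-- The direct limit of a direct system of weak `V`-modules. -/
def dirLim : WeakModule V where
  carrier := dirLimCarrier α
  mode := dirLimMode α
  truncation a z := by
    obtain ⟨i, w, rfl⟩ := exists_dirLimOf α z
    obtain ⟨N, h⟩ := (α.obj i).truncation a w
    exact ⟨N, fun n hn => by rw [dirLimMode_of, h n hn, map_zero]⟩
  vacuum n z := by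
    obtain ⟨i, w, rfl⟩ := exists_dirLimOf α z
    rw [dirLimMode_of, (α.obj i).vacuum]
    split_ifs <;> simp
  jacobi z := by
    obtain ⟨i, w, rfl⟩ := exists_dirLimOf α z
    exact jacobi_map (α.obj i).truncation (dirLimOf α i)
      (fun n a w => (dirLimMode_of α n a i w).symm) ((α.obj i).jacobi w)
  derivative n a z := by
    obtain ⟨i, w, rfl⟩ := exists_dirLimOf α z
    rw [dirLimMode_of, dirLimMode_of, (α.obj i).derivative, map_smul]

namespace dirLim

/-- The canonical morphisms `φ_i` into the direct limit. -/
def φ (i : I) : α.obj i ⟶ dirLim α :=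
  ofLin (dirLimOf α i) (fun n a w => (dirLimMode_of α n a i w).symm)

open Classical in
lemma map_φ {i j : I} (h : i ⟶ j) : α.map h ≫ φ α j = φ α i :=
  hom_ext fun _ => Module.DirectLimit.of_f (hij := leOfHom h)

lemma exists_rep (z : (dirLim α).carrier) : ∃ i w, lin (φ α i) w = z :=
  exists_dirLimOf α z

open Classical in
lemma exists_eq_zero {i : I} {w : (α.obj i).carrier} (h : lin (φ α i) w = 0) :
    ∃ (j : I) (f : i ⟶ j), lin (α.map f) w = 0 := by
  obtain ⟨j, hij, h⟩ := Module.DirectLimit.of.zero_exact h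
  exact ⟨j, homOfLE hij, h⟩

variable {α}

lemma ext {X : WeakModule V} {f g : dirLim α ⟶ X} (h : ∀ i, φ α i ≫ f = φ α i ≫ g) : f = g := by
  refine hom_ext fun z => ?_
  obtain ⟨i, w, rfl⟩ := exists_rep α z
  exact LinearMap.congr_fun (congrArg lin (h i)) w

open Classical in
/-- The linear map out of a direct limit induced by a target of the direct system. -/
def descLin {X : WeakModule V} (ψ : ∀ i, α.obj i ⟶ X)
    (hψ : ∀ (i j : I) (h : i ⟶ j), α.map h ≫ ψ j = ψ i) : dirLimCarrier α →ₗ[ℂ] X.carrier :=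
  Module.DirectLimit.lift ℂ I (fun i => (α.obj i).carrier) (trans α)
    (fun i => lin (ψ i)) (fun i j hij w =>
      LinearMap.congr_fun (congrArg lin (hψ i j (homOfLE hij))) w)

open Classical in
lemma descLin_of {X : WeakModule V} (ψ : ∀ i, α.obj i ⟶ X)
    (hψ : ∀ (i j : I) (h : i ⟶ j), α.map h ≫ ψ j = ψ i) (i : I) (w : (α.obj i).carrier) :
    descLin ψ hψ (dirLimOf α i w) = lin (ψ i) w :=
  Module.DirectLimit.lift_of _ _ _

/-- The morphism out of a direct limit induced by a target of the direct system. -/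
def desc {X : WeakModule V} (ψ : ∀ i, α.obj i ⟶ X)
    (hψ : ∀ (i j : I) (h : i ⟶ j), α.map h ≫ ψ j = ψ i) : dirLim α ⟶ X :=
  ofLin (descLin ψ hψ) (fun n a z => by
    obtain ⟨i, w, rfl⟩ := exists_dirLimOf α z
    exact (congrArg (descLin ψ hψ) (dirLimMode_of α n a i w)).trans
      ((descLin_of ψ hψ i _).trans ((lin_mode (ψ i) n a w).trans
        (congrArg (X.mode n a) (descLin_of ψ hψ i w).symm))))

@[simp] lemma φ_desc {X : WeakModule V} (ψ : ∀ i, α.obj i ⟶ X)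
    (hψ : ∀ (i j : I) (h : i ⟶ j), α.map h ≫ ψ j = ψ i) (i : I) :
    φ α i ≫ desc ψ hψ = ψ i :=
  hom_ext fun w => descLin_of ψ hψ i w

variable (α)

/-- The direct limit with its canonical morphisms, as a cocone. -/
def cocone : Cocone α where
  pt := dirLim α
  ι := { app := φ α, naturality := fun _ _ h => by simpa using map_φ α h }

/-- The universal property of the direct limit. -/
def isColimit : IsColimit (cocone α) where
  desc s := desc (fun i => s.ι.app i) (fun _ _ h => s.w h)
  fac _ i := φ_desc _ _ i
  uniq _ _ h := ext fun i => (h i).trans (φ_desc _ _ i).symm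

end dirLim

end DirLim

/-! ### The direct limit completion -/

variable (P : ObjectProperty (WeakModule V))

/-- The direct limit completion `Ind(C)`: the weak `V`-modules which are isomorphic to direct
limits, in the category of weak modules, of direct systems `α : I ⥤ C`, where `I` is a directed
set. -/
def Ind : ObjectProperty (WeakModule V) := fun X =>
  ∃ (I : Type u) (_ : Preorder I) (_ : Nonempty I) (_ : IsDirectedOrder I)
    (α : I ⥤ P.FullSubcategory) (c : Cocone (α ⋙ P.ι)),
    Nonempty (IsColimit c) ∧ Nonempty (X ≅ c.pt)

/-- The set `I_X` of submodules of `X` which are objects of `C`, ordered by inclusion. -/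
abbrev CSub (X : WeakModule V) : Type u := { N : WeakSubmodule X // P N.toWeakModule }

variable {P}

open WeakModule

namespace CSub

variable {X : WeakModule V}

/-- A `C`-submodule, as an object of `C`. -/
abbrev toC (W : CSub P X) : P.FullSubcategory := ⟨W.1.toWeakModule, W.2⟩

/-- The inclusion `i_W : W ⟶ X`. -/
abbrev i (W : CSub P X) : W.toC.obj ⟶ X := W.1.incl

/-- The inclusion `f_W^W' : W ⟶ W'` for `W ⊆ W'`. -/
def f {W W' : CSub P X} (h : W ≤ W') : W.toC ⟶ W'.toC :=
  ObjectProperty.homMk (WeakSubmodule.inclOfLE h)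

@[simp] lemma f_i {W W' : CSub P X} (h : W ≤ W') : (f h).hom ≫ W'.i = W.i := rfl

@[simp] lemma f_i_assoc {W W' : CSub P X} (h : W ≤ W') {Z : WeakModule V} (k : X ⟶ Z) :
    (f h).hom ≫ W'.i ≫ k = W.i ≫ k := rfl

lemma i_injective (W : CSub P X) : Function.Injective (lin W.i) := Subtype.val_injective

lemma cancel_i {A : WeakModule V} {W : CSub P X} {g h : A ⟶ W.toC.obj}
    (e : g ≫ W.i = h ≫ W.i) : g = h :=
  hom_ext fun a => W.i_injective (LinearMap.congr_fun (congrArg lin e) a)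

@[simp] lemma f_refl (W : CSub P X) : f (le_refl W) = 𝟙 _ := rfl

@[simp] lemma f_f {W W' W'' : CSub P X} (h : W ≤ W') (h' : W' ≤ W'') :
    f h ≫ f h' = f (h.trans h') := rfl

end CSub

/-- Transport of an equation between morphisms of `C` to weak modules. -/
lemma hom_congr {A B : P.FullSubcategory} {g h : A ⟶ B} (e : g = h) : g.hom = h.hom := e ▸ rfl

/-- Evaluation of an equation between morphisms. -/
lemma lin_congr {A B : WeakModule V} {g h : A ⟶ B} (e : g = h) (w : A.carrier) :
    lin g w = lin h w := e ▸ rfl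

variable [IsModuleSubcategory P]

/-- The image of a morphism from an object of `C`, as a `C`-submodule. -/
def im {A : P.FullSubcategory} {X : WeakModule V} (g : A.obj ⟶ X) : CSub P X :=
  letI N : WeakSubmodule X :=
    { LinearMap.range (lin g) with
      mode_mem := by
        rintro n a _ ⟨w, rfl⟩
        exact ⟨A.obj.mode n a w, lin_mode g n a w⟩ }
  ⟨N, IsModuleSubcategory.quotient (W := A.obj)
    (ofLin (X := N.toWeakModule) (lin g).rangeRestrict
      (fun n a w => Subtype.ext (lin_mode g n a w)))
    (LinearMap.surjective_rangeRestrict _) A.property⟩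

/-- The surjection of the source of a morphism onto its image. -/
def toIm {A : P.FullSubcategory} {X : WeakModule V} (g : A.obj ⟶ X) : A ⟶ (im g).toC :=
  ObjectProperty.homMk (ofLin (X := (im g).1.toWeakModule) (lin g).rangeRestrict
      (fun n a w => Subtype.ext (lin_mode g n a w)))

@[simp] lemma toIm_i_assoc {A : P.FullSubcategory} {X Z : WeakModule V} (g : A.obj ⟶ X)
    (k : X ⟶ Z) : (toIm g).hom ≫ (im g).i ≫ k = g ≫ k := rfl

@[simp] lemma toIm_i {A : P.FullSubcategory} {X : WeakModule V} (g : A.obj ⟶ X) :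
    (toIm g).hom ≫ (im g).i = g := rfl

lemma im_le {A : P.FullSubcategory} {X : WeakModule V} (g : A.obj ⟶ X) {W : CSub P X}
    (a : A ⟶ W.toC) (h : a.hom ≫ W.i = g) : im g ≤ W := by
  subst h
  rintro _ ⟨w, rfl⟩
  exact (lin a.hom w).2

section Directed

variable (X : WeakModule V)

instance : Nonempty (CSub P X) :=
  letI N : WeakSubmodule X :=
    { (⊥ : Submodule ℂ X.carrier) with
      mode_mem := by
        rintro n a w (rfl : w = 0)
        simp }
  ⟨⟨N, IsModuleSubcategory.zero _ (inferInstanceAs (Subsingleton (⊥ : Submodule ℂ X.carrier)))⟩⟩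

/-- The morphism out of a direct sum with given components. -/
def prodDesc {W W' X : WeakModule V} (g : W ⟶ X) (h : W' ⟶ X) : W.prod W' ⟶ X :=
  ofLin (W := W.prod W') ((lin g).coprod (lin h)) (fun n a w => by
    change lin g (W.mode n a w.1) + lin h (W'.mode n a w.2) = X.mode n a (lin g w.1 + lin h w.2)
    simp [lin_mode])

lemma exists_ge₂ (W W' : CSub P X) : ∃ W'' : CSub P X, W ≤ W'' ∧ W' ≤ W'' := by
  refine ⟨im (A := ⟨W.1.toWeakModule.prod W'.1.toWeakModule,
    IsModuleSubcategory.prod _ _ W.2 W'.2⟩) (prodDesc W.i W'.i), ?_, ?_⟩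
  · intro w hw
    refine ⟨((⟨w, hw⟩ : W.1.toSubmodule), (0 : W'.1.toSubmodule)), ?_⟩
    change w + 0 = w
    simp
  · intro w hw
    refine ⟨((0 : W.1.toSubmodule), (⟨w, hw⟩ : W'.1.toSubmodule)), ?_⟩
    change 0 + w = w
    simp

instance : IsDirectedOrder (CSub P X) := ⟨fun W W' => exists_ge₂ X W W'⟩

end Directed

/-- The product of two directed sets, with the product order. -/
structure Idx (I J : Type u) : Type u where
  fst : I
  snd : J

section Idx

variable {I J : Type u} [Preorder I] [Preorder J]

instance : Preorder (Idx I J) where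
  le a b := a.fst ≤ b.fst ∧ a.snd ≤ b.snd
  le_refl _ := ⟨le_rfl, le_rfl⟩
  le_trans _ _ _ h h' := ⟨h.1.trans h'.1, h.2.trans h'.2⟩

instance [Nonempty I] [Nonempty J] : Nonempty (Idx I J) :=
  ⟨⟨Classical.arbitrary I, Classical.arbitrary J⟩⟩

instance [IsDirectedOrder I] [IsDirectedOrder J] : IsDirectedOrder (Idx I J) := ⟨fun a b => by
  obtain ⟨i, h₁, h₂⟩ := exists_ge_ge a.fst b.fst
  obtain ⟨j, h₃, h₄⟩ := exists_ge_ge a.snd b.snd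
  exact ⟨⟨i, j⟩, ⟨h₁, h₃⟩, ⟨h₂, h₄⟩⟩⟩

lemma le_fst {a b : Idx I J} (h : a ≤ b) : a.fst ≤ b.fst := And.left h
lemma le_snd {a b : Idx I J} (h : a ≤ b) : a.snd ≤ b.snd := And.right h

end Idx

section FinitePresentation

variable {I : Type u} [Preorder I] [Nonempty I] [IsDirectedOrder I] (α : I ⥤ P.FullSubcategory)

/-- The direct limit, in the category of weak modules, of a direct system in `C`. -/
abbrev lim : WeakModule V := dirLim (α ⋙ P.ι)

/-- The canonical morphisms into the direct limit of a direct system in `C`. -/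
abbrev limφ (i : I) : (α.obj i).obj ⟶ lim α := dirLim.φ (α ⋙ P.ι) i

lemma map_limφ {i j : I} (h : i ⟶ j) : (α.map h).hom ≫ limφ α j = limφ α i :=
  dirLim.map_φ (α ⋙ P.ι) h

lemma lim_mem : Ind P (lim α) :=
  ⟨I, _, ‹_›, ‹_›, α, dirLim.cocone _, ⟨dirLim.isColimit _⟩, ⟨Iso.refl _⟩⟩

/-- Equalizers of morphisms, as submodules. -/
def eqSub {A X : WeakModule V} (g h : A ⟶ X) : WeakSubmodule A :=
  { LinearMap.eqLocus (lin g) (lin h) with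
    mode_mem := by
      intro n a w (hw : lin g w = lin h w)
      change lin g _ = lin h _
      rw [lin_mode, lin_mode, hw] }

/-- Two morphisms from an object of `C` to one stage of a direct system which agree in the limit
agree at some later stage. -/
lemma eq_of_limφ {A : P.FullSubcategory} {i : I} (g h : A ⟶ α.obj i)
    (e : g.hom ≫ limφ α i = h.hom ≫ limφ α i) :
    ∃ (j : I) (t : i ⟶ j), g ≫ α.map t = h ≫ α.map t := by
  classical
  obtain ⟨S, hS⟩ := IsModuleSubcategory.finitelyGenerated A.obj A.property
  have key : ∀ T : Finset A.obj.carrier, ∃ (j : I) (t : i ⟶ j), ∀ w ∈ T,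
      lin (g ≫ α.map t).hom w = lin (h ≫ α.map t).hom w := by
    intro T
    induction T using Finset.induction_on with
    | empty => exact ⟨i, 𝟙 _, by simp⟩
    | insert w T _ ih =>
      obtain ⟨j, t, ht⟩ := ih
      have h0 : lin (limφ α i) (lin (g - h).hom w) = 0 := by
        have := LinearMap.congr_fun (congrArg lin e) w
        change lin (limφ α i) (lin g.hom w - lin h.hom w) = 0
        rw [map_sub]
        exact sub_eq_zero.2 this
      obtain ⟨k, s, hs⟩ := dirLim.exists_eq_zero _ h0
      have hs' : lin (α.map s).hom (lin g.hom w) = lin (α.map s).hom (lin h.hom w) := by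
        rw [← sub_eq_zero, ← map_sub]
        exact hs
      obtain ⟨l, hj, hk⟩ := exists_ge_ge j k
      refine ⟨l, t ≫ homOfLE hj, fun w' hw' => ?_⟩
      rcases Finset.mem_insert.1 hw' with rfl | hw'
      · rw [show t ≫ homOfLE hj = s ≫ homOfLE hk from rfl, α.map_comp]
        exact congrArg (lin (α.map (homOfLE hk)).hom) hs'
      · rw [α.map_comp]
        exact congrArg (lin (α.map (homOfLE hj)).hom) (ht w' hw')
  obtain ⟨j, t, ht⟩ := key S
  refine ⟨j, t, ObjectProperty.hom_ext _ (hom_ext fun w => ?_)⟩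
  exact hS (eqSub (g ≫ α.map t).hom (h ≫ α.map t).hom) ht w

/-- Every morphism from an object of `C` to a direct limit factors through some stage. -/
lemma exists_lift {A : P.FullSubcategory} (h : A.obj ⟶ lim α) :
    ∃ (i : I) (a : A ⟶ α.obj i), a.hom ≫ limφ α i = h := by
  classical
  obtain ⟨S, hS⟩ := IsModuleSubcategory.finitelyGenerated A.obj A.property
  -- the image of `h` is contained in the image of some `φ_i`
  have key : ∀ T : Finset A.obj.carrier, ∃ i : I, ∀ w ∈ T,
      ∃ x, lin (limφ α i) x = lin h w := by
    intro T
    induction T using Finset.induction_on with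
    | empty => exact ⟨Classical.arbitrary I, by simp⟩
    | insert w T _ ih =>
      obtain ⟨j, hj⟩ := ih
      obtain ⟨k, x, hx⟩ := dirLim.exists_rep _ (lin h w)
      obtain ⟨l, hjl, hkl⟩ := exists_ge_ge j k
      have up : ∀ {m : I} (hm : m ≤ l) (y : (α.obj m).obj.carrier),
          lin (limφ α l) (lin (α.map (homOfLE hm)).hom y) = lin (limφ α m) y := fun hm y =>
        LinearMap.congr_fun (congrArg lin (map_limφ α (homOfLE hm))) y
      refine ⟨l, fun w' hw' => ?_⟩
      rcases Finset.mem_insert.1 hw' with rfl | hw'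
      · exact ⟨_, (up hkl x).trans hx⟩
      · obtain ⟨y, hy⟩ := hj w' hw'
        exact ⟨_, (up hjl y).trans hy⟩
  obtain ⟨i, hi⟩ := key S
  have hrange : ∀ w, ∃ x, lin (limφ α i) x = lin h w :=
    hS { (LinearMap.range (lin (limφ α i))).comap (lin h) with
      mode_mem := by
        rintro n a w ⟨x, hx⟩
        exact ⟨(α.obj i).obj.mode n a x, by rw [lin_mode, lin_mode]; exact congrArg _ hx⟩ } hi
  -- the kernel of `φ_i` is the kernel of some transition map
  let K : WeakSubmodule (α.obj i).obj := eqSub (limφ α i) 0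
  have hK : P K.toWeakModule :=
    IsModuleSubcategory.submodule K.incl Subtype.val_injective (α.obj i).property
  obtain ⟨j, t, ht⟩ := eq_of_limφ α (A := ⟨K.toWeakModule, hK⟩) (i := i)
    (ObjectProperty.homMk K.incl) (ObjectProperty.homMk 0) (hom_ext fun w => by
      have h₁ : lin (limφ α i) w.1 = 0 := w.2
      have h₂ : lin (limφ α i) (0 : (α.obj i).obj.carrier) = 0 := map_zero _
      exact h₁.trans h₂.symm)
  have ht' : ∀ x, lin (limφ α i) x = 0 → lin (α.map t).hom x = 0 := fun x hx => by
    have h₁ : lin (α.map t).hom x = lin (α.map t).hom (0 : (α.obj i).obj.carrier) :=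
      LinearMap.congr_fun (congrArg (fun g => lin (InducedCategory.Hom.hom g)) ht)
        (⟨x, hx⟩ : K.toSubmodule)
    rw [h₁, map_zero]
  have ht'' : ∀ x y, lin (limφ α i) x = lin (limφ α i) y →
      lin (α.map t).hom x = lin (α.map t).hom y := fun x y hxy => by
    rw [← sub_eq_zero, ← map_sub]
    exact ht' _ (by rw [map_sub]; exact sub_eq_zero.2 hxy)
  choose r hr using hrange
  have hφ : ∀ x, lin (limφ α j) (lin (α.map t).hom x) = lin (limφ α i) x :=
    fun x => LinearMap.congr_fun (congrArg lin (map_limφ α t)) x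
  refine ⟨j, ObjectProperty.homMk (ofLin
    { toFun := fun w => lin (α.map t).hom (r w)
      map_add' := fun w w' => ?_
      map_smul' := fun c w => ?_ } fun n a w => ?_), hom_ext fun w => (hφ _).trans (hr w)⟩
  · rw [← map_add]
    apply ht''
    rw [map_add, hr, hr, hr, map_add]
  · rw [RingHom.id_apply, ← map_smul]
    apply ht''
    rw [map_smul, hr, hr, map_smul]
  · change lin (α.map t).hom (r (A.obj.mode n a w)) =
      (α.obj j).obj.mode n a (lin (α.map t).hom (r w))
    rw [← lin_mode]
    apply ht''
    rw [lin_mode, hr, hr, lin_mode]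

end FinitePresentation

/-! ### The direct system of `C`-submodules -/

section SubSys

/-- The direct system `α_X : I_X ⥤ C` of all `C`-submodules of `X`. -/
def subSys (X : WeakModule V) : CSub P X ⥤ P.FullSubcategory where
  obj W := W.toC
  map h := CSub.f (leOfHom h)
  map_id _ := rfl
  map_comp _ _ := rfl

/-- The morphism `Q_X : lim α_X ⟶ X` induced by the inclusions. -/
def subQ (X : WeakModule V) : lim (subSys (P := P) X) ⟶ X :=
  dirLim.desc (α := subSys (P := P) X ⋙ P.ι) (fun W => W.i) (fun _ _ _ => rfl)

/-- The canonical morphism `W ⟶ lim α_X` for a `C`-submodule `W` of `X`. -/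
def subφ {X : WeakModule V} (W : CSub P X) : W.toC.obj ⟶ lim (subSys (P := P) X) :=
  limφ (subSys X) W

variable {X : WeakModule V}

lemma sub_ext {Z : WeakModule V} {g h : lim (subSys (P := P) X) ⟶ Z}
    (e : ∀ W : CSub P X, subφ W ≫ g = subφ W ≫ h) : g = h :=
  dirLim.ext e

/-- The universal property of `lim α_X`. -/
def subDesc {Z : WeakModule V} (ψ : ∀ W : CSub P X, W.toC.obj ⟶ Z)
    (hψ : ∀ (W U : CSub P X) (h : W ≤ U), (CSub.f h).hom ≫ ψ U = ψ W) :
    lim (subSys (P := P) X) ⟶ Z :=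
  dirLim.desc (α := subSys (P := P) X ⋙ P.ι) ψ (fun W U h => hψ W U (leOfHom h))

lemma subφ_desc {Z : WeakModule V} (ψ : ∀ W : CSub P X, W.toC.obj ⟶ Z) (hψ) (W : CSub P X) :
    subφ W ≫ subDesc ψ hψ = ψ W :=
  dirLim.φ_desc (α := subSys (P := P) X ⋙ P.ι) _ _ W

lemma subφ_Q (W : CSub P X) : subφ W ≫ subQ X = W.i :=
  dirLim.φ_desc (α := subSys (P := P) X ⋙ P.ι) _ _ W

lemma map_subφ {W U : CSub P X} (h : W ≤ U) : (CSub.f h).hom ≫ subφ U = subφ W :=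
  map_limφ (subSys X) (homOfLE h)

/-- Bijective homomorphisms are isomorphisms. -/
lemma isIso_of_bijective {W X : WeakModule V} (g : W ⟶ X) (h : Function.Injective (lin g))
    (h' : Function.Surjective (lin g)) : IsIso g := by
  let e := LinearEquiv.ofBijective (lin g) ⟨h, h'⟩
  refine ⟨ofLin e.symm.toLinearMap (fun n a x => ?_), hom_ext fun w => ?_, hom_ext fun x => ?_⟩
  · apply h
    change e (e.symm _) = lin g _
    rw [lin_mode, e.apply_symm_apply]
    exact congrArg _ (e.apply_symm_apply x).symm
  · exact e.symm_apply_apply w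
  · exact e.apply_symm_apply x

lemma subQ_isIso_of_exists_mem
    (hX : ∀ x : X.carrier, ∃ (W : CSub P X) (w : W.toC.obj.carrier), lin W.i w = x) :
    IsIso (subQ (P := P) X) := by
  refine isIso_of_bijective _ ((injective_iff_map_eq_zero _).2 fun z hz => ?_) fun x => ?_
  · obtain ⟨W, w, rfl⟩ := dirLim.exists_rep (subSys (P := P) X ⋙ P.ι) z
    have h := (lin_congr (subφ_Q W) w).symm.trans hz
    have h' : w = (0 : W.toC.obj.carrier) := W.i_injective (h.trans (map_zero _).symm)
    rw [h']
    exact map_zero (lin (subφ W))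
  · obtain ⟨W, w, rfl⟩ := hX x
    exact ⟨lin (subφ W) w, lin_congr (subφ_Q W) w⟩

/-- Every vector of a weak module in `Ind(C)` is contained in a `C`-submodule. -/
lemma exists_mem (hX : Ind P X) (x : X.carrier) :
    ∃ (W : CSub P X) (w : W.toC.obj.carrier), lin W.i w = x := by
  obtain ⟨I, _, _, _, α, c, ⟨hc⟩, ⟨e⟩⟩ := hX
  let e' : lim α ≅ X := ((dirLim.isColimit (α ⋙ P.ι)).coconePointUniqueUpToIso hc) ≪≫ e.symm
  obtain ⟨i, w, hw⟩ := dirLim.exists_rep (α ⋙ P.ι) (lin e'.inv x)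
  refine ⟨im (A := α.obj i) (limφ α i ≫ e'.hom), lin (toIm (limφ α i ≫ e'.hom)).hom w, ?_⟩
  have h : lin e'.hom (lin e'.inv x) = x := lin_congr e'.inv_hom_id x
  rw [← h, ← hw]
  exact lin_congr (toIm_i (A := α.obj i) (limφ α i ≫ e'.hom)) w

/-- `Q_X` is an isomorphism for `X` in `Ind(C)`. -/
lemma subQ_isIso (hX : Ind P X) : IsIso (subQ (P := P) X) :=
  subQ_isIso_of_exists_mem (exists_mem hX)

/-- Objects of `C` are objects of `Ind(C)`. -/
lemma le_Ind : P ≤ Ind P := fun X hX => by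
  have h : IsIso (subQ (P := P) X) := subQ_isIso_of_exists_mem fun x =>
    ⟨im (A := ⟨X, hX⟩) (𝟙 X), lin (toIm (A := ⟨X, hX⟩) (𝟙 X)).hom x, rfl⟩
  exact ⟨CSub P X, _, inferInstance, inferInstance, subSys X, dirLim.cocone _,
    ⟨dirLim.isColimit _⟩, ⟨(asIso (subQ X)).symm⟩⟩

end SubSys

/-! ### The tensor product of weak modules -/

variable [MonoidalCategory P.FullSubcategory]

section Tensor

/-- The direct system `α_X ⊠ α_Y` on `I_X × I_Y`. -/
def tensSys (X Y : WeakModule V) : Idx (CSub P X) (CSub P Y) ⥤ P.FullSubcategory where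
  obj W := W.fst.toC ⊗ W.snd.toC
  map h := CSub.f (le_fst (leOfHom h)) ⊗ₘ CSub.f (le_snd (leOfHom h))
  map_id _ := by simp
  map_comp _ _ := by simp

variable (P) in
/-- The tensor product `X ⊠̂ Y = lim α_X ⊠ α_Y`. -/
def tens (X Y : WeakModule V) : WeakModule V := lim (tensSys (P := P) X Y)

/-- The canonical morphism `φ_{W,W'} : W ⊠ W' ⟶ X ⊠̂ Y`. -/
def tensφ {X Y : WeakModule V} (W : CSub P X) (W' : CSub P Y) :
    (W.toC ⊗ W'.toC).obj ⟶ tens P X Y :=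
  limφ (tensSys X Y) ⟨W, W'⟩

lemma map_tensφ {X Y : WeakModule V} {W U : CSub P X} {W' U' : CSub P Y} (h : W ≤ U)
    (h' : W' ≤ U') : (CSub.f h ⊗ₘ CSub.f h').hom ≫ tensφ U U' = tensφ W W' :=
  map_limφ (tensSys X Y) (i := ⟨W, W'⟩) (j := ⟨U, U'⟩) (homOfLE ⟨h, h'⟩)

lemma tens_ext {X Y Z : WeakModule V} {g h : tens P X Y ⟶ Z}
    (e : ∀ (W : CSub P X) (W' : CSub P Y), tensφ W W' ≫ g = tensφ W W' ≫ h) : g = h :=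
  dirLim.ext fun i => e i.fst i.snd

/-- The universal property of `X ⊠̂ Y`. -/
def tensDesc {X Y Z : WeakModule V}
    (ψ : ∀ (W : CSub P X) (W' : CSub P Y), (W.toC ⊗ W'.toC).obj ⟶ Z)
    (hψ : ∀ (W U : CSub P X) (W' U' : CSub P Y) (h : W ≤ U) (h' : W' ≤ U'),
      (CSub.f h ⊗ₘ CSub.f h').hom ≫ ψ U U' = ψ W W') : tens P X Y ⟶ Z :=
  dirLim.desc (fun i => ψ i.fst i.snd)
    (fun i j h => hψ i.fst j.fst i.snd j.snd (le_fst (leOfHom h)) (le_snd (leOfHom h)))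

@[simp] lemma tensφ_desc {X Y Z : WeakModule V}
    (ψ : ∀ (W : CSub P X) (W' : CSub P Y), (W.toC ⊗ W'.toC).obj ⟶ Z)
    (hψ : ∀ (W U : CSub P X) (W' U' : CSub P Y) (h : W ≤ U) (h' : W' ≤ U'),
      (CSub.f h ⊗ₘ CSub.f h').hom ≫ ψ U U' = ψ W W') (W : CSub P X) (W' : CSub P Y) :
    tensφ W W' ≫ tensDesc ψ hψ = ψ W W' :=
  dirLim.φ_desc (α := tensSys X Y ⋙ P.ι) _ _ ⟨W, W'⟩

lemma tens_exists_rep {X Y : WeakModule V} (z : (tens P X Y).carrier) :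
    ∃ (W : CSub P X) (W' : CSub P Y) (w : (W.toC ⊗ W'.toC).obj.carrier),
      lin (tensφ W W') w = z := by
  obtain ⟨i, w, h⟩ := dirLim.exists_rep (tensSys (P := P) X Y ⋙ P.ι) z
  exact ⟨i.fst, i.snd, w, h⟩

lemma tens_exists_eq_zero {X Y : WeakModule V} {W : CSub P X} {W' : CSub P Y}
    {w : (W.toC ⊗ W'.toC).obj.carrier} (h : lin (tensφ W W') w = 0) :
    ∃ (U : CSub P X) (U' : CSub P Y) (t : W ≤ U) (t' : W' ≤ U'),
      lin (CSub.f t ⊗ₘ CSub.f t').hom w = 0 := by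
  obtain ⟨j, t, ht⟩ := dirLim.exists_eq_zero (tensSys (P := P) X Y ⋙ P.ι) (i := ⟨W, W'⟩) h
  exact ⟨j.fst, j.snd, le_fst (leOfHom t), le_snd (leOfHom t), ht⟩

/-- The morphism `A ⊠ B ⟶ X ⊠̂ Y` induced by morphisms `g : A ⟶ X` and `h : B ⟶ Y`, where `A`
and `B` are objects of `C`: the composite `A ⊠ B ⟶ im g ⊠ im h ⟶ X ⊠̂ Y`. -/
def tensMk {A B : P.FullSubcategory} {X Y : WeakModule V} (g : A.obj ⟶ X) (h : B.obj ⟶ Y) :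
    (A ⊗ B).obj ⟶ tens P X Y :=
  (toIm g ⊗ₘ toIm h).hom ≫ tensφ (im g) (im h)

/-- Composition in `C` of tensor products of morphisms. -/
lemma tensorHom_comp_hom {A B A' B' A'' B'' : P.FullSubcategory} (a : A ⟶ A') (b : B ⟶ B')
    (a' : A' ⟶ A'') (b' : B' ⟶ B'') {X : WeakModule V} (k : (A'' ⊗ B'').obj ⟶ X) :
    (a ⊗ₘ b).hom ≫ (a' ⊗ₘ b').hom ≫ k = ((a ≫ a') ⊗ₘ (b ≫ b')).hom ≫ k := by
  rw [← tensorHom_comp_tensorHom, ObjectProperty.FullSubcategory.comp_hom, Category.assoc]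

lemma tensMk_eq {A B : P.FullSubcategory} {X Y : WeakModule V} {W : CSub P X} {W' : CSub P Y}
    (a : A ⟶ W.toC) (b : B ⟶ W'.toC) :
    tensMk (a.hom ≫ W.i) (b.hom ≫ W'.i) = (a ⊗ₘ b).hom ≫ tensφ W W' := by
  have h : toIm (a.hom ≫ W.i) ≫ CSub.f (im_le _ a rfl) = a := rfl
  have h' : toIm (b.hom ≫ W'.i) ≫ CSub.f (im_le _ b rfl) = b := rfl
  have := tensorHom_comp_hom (toIm (a.hom ≫ W.i)) (toIm (b.hom ≫ W'.i))
    (CSub.f (im_le _ a rfl)) (CSub.f (im_le _ b rfl)) (tensφ W W')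
  rw [map_tensφ, h, h'] at this
  exact this

lemma tensMk_i {X Y : WeakModule V} (W : CSub P X) (W' : CSub P Y) :
    tensMk (A := W.toC) (B := W'.toC) W.i W'.i = tensφ W W' := by
  refine (tensMk_eq (𝟙 W.toC) (𝟙 W'.toC)).trans ?_
  rw [id_tensorHom_id]
  rfl

lemma comp_tensMk {A B A' B' : P.FullSubcategory} {X Y : WeakModule V} (a : A ⟶ A') (b : B ⟶ B')
    (g : A'.obj ⟶ X) (h : B'.obj ⟶ Y) :
    (a ⊗ₘ b).hom ≫ tensMk g h = tensMk (a.hom ≫ g) (b.hom ≫ h) :=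
  (tensorHom_comp_hom a b (toIm g) (toIm h) _).trans (tensMk_eq (a ≫ toIm g) (b ≫ toIm h)).symm

lemma comp_tensMk_assoc {A B A' B' : P.FullSubcategory} {X Y Z : WeakModule V} (a : A ⟶ A')
    (b : B ⟶ B') (g : A'.obj ⟶ X) (h : B'.obj ⟶ Y) (k : tens P X Y ⟶ Z) :
    (a ⊗ₘ b).hom ≫ tensMk g h ≫ k = tensMk (a.hom ≫ g) (b.hom ≫ h) ≫ k := by
  rw [← comp_tensMk, Category.assoc]

/-- The tensor product `F ⊠̂ G` of morphisms. -/
def tensMap {X X' Y Y' : WeakModule V} (F : X ⟶ X') (G : Y ⟶ Y') :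
    tens P X Y ⟶ tens P X' Y' :=
  tensDesc (fun W W' => (toIm (A := W.toC) (W.i ≫ F) ⊗ₘ toIm (A := W'.toC) (W'.i ≫ G)).hom ≫
      tensφ (im (A := W.toC) (W.i ≫ F)) (im (A := W'.toC) (W'.i ≫ G)))
    (fun _ U _ U' h h' => comp_tensMk (CSub.f h) (CSub.f h') (U.i ≫ F) (U'.i ≫ G))

lemma tensφ_map {X X' Y Y' : WeakModule V} (F : X ⟶ X') (G : Y ⟶ Y') (W : CSub P X)
    (W' : CSub P Y) :
    tensφ W W' ≫ tensMap F G = tensMk (A := W.toC) (B := W'.toC) (W.i ≫ F) (W'.i ≫ G) := by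
  unfold tensMap
  exact tensφ_desc _ _ W W'

lemma tensMk_map {A B : P.FullSubcategory} {X X' Y Y' : WeakModule V} (g : A.obj ⟶ X)
    (h : B.obj ⟶ Y) (F : X ⟶ X') (G : Y ⟶ Y') :
    tensMk g h ≫ tensMap F G = tensMk (g ≫ F) (h ≫ G) := by
  rw [tensMk, Category.assoc, tensφ_map]
  exact comp_tensMk (toIm g) (toIm h) ((im g).i ≫ F) ((im h).i ≫ G)

lemma tensMk_map_assoc {A B : P.FullSubcategory} {X X' Y Y' Z : WeakModule V} (g : A.obj ⟶ X)
    (h : B.obj ⟶ Y) (F : X ⟶ X') (G : Y ⟶ Y') (k : tens P X' Y' ⟶ Z) :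
    tensMk g h ≫ tensMap F G ≫ k = tensMk (g ≫ F) (h ≫ G) ≫ k := by
  rw [← tensMk_map, Category.assoc]

lemma tensMk_ext {X Y Z : WeakModule V} {g h : tens P X Y ⟶ Z}
    (e : ∀ (A B : P.FullSubcategory) (p : A.obj ⟶ X) (q : B.obj ⟶ Y),
      tensMk p q ≫ g = tensMk p q ≫ h) : g = h :=
  tens_ext fun W W' => by simpa only [tensMk_i] using e W.toC W'.toC W.i W'.i

/-- Every morphism from an object of `C` to `X ⊠̂ Y` factors through some `φ_{W,W'}`. -/
lemma exists_tens_lift {A : P.FullSubcategory} {X Y : WeakModule V} (h : A.obj ⟶ tens P X Y) :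
    ∃ (W : CSub P X) (W' : CSub P Y) (a : A ⟶ W.toC ⊗ W'.toC), h = a.hom ≫ tensφ W W' := by
  obtain ⟨i, a, rfl⟩ := exists_lift (tensSys X Y) h
  exact ⟨i.fst, i.snd, a, rfl⟩

lemma exists_tensMk_lift {A : P.FullSubcategory} {X Y : WeakModule V} (h : A.obj ⟶ tens P X Y) :
    ∃ (B D : P.FullSubcategory) (p : B.obj ⟶ X) (q : D.obj ⟶ Y) (a : A ⟶ B ⊗ D),
      h = a.hom ≫ tensMk p q := by
  obtain ⟨W, W', a, ha⟩ := exists_tens_lift h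
  exact ⟨W.toC, W'.toC, W.i, W'.i, a, by rw [ha, tensMk_i]⟩

lemma eq_of_tensφ {A : P.FullSubcategory} {X Y : WeakModule V} {W : CSub P X} {W' : CSub P Y}
    (g h : A ⟶ W.toC ⊗ W'.toC) (e : g.hom ≫ tensφ W W' = h.hom ≫ tensφ W W') :
    ∃ (U : CSub P X) (U' : CSub P Y) (t : W ≤ U) (t' : W' ≤ U'),
      g ≫ (CSub.f t ⊗ₘ CSub.f t') = h ≫ (CSub.f t ⊗ₘ CSub.f t') := by
  obtain ⟨j, t, ht⟩ := eq_of_limφ (tensSys X Y) (i := ⟨W, W'⟩) g h e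
  exact ⟨j.fst, j.snd, le_fst (leOfHom t), le_snd (leOfHom t), ht⟩

lemma tensMk_comp_right {A B D : P.FullSubcategory} {X Y : WeakModule V} (p : A.obj ⟶ X) (a : B ⟶ D)
    (q : D.obj ⟶ Y) : tensMk p (a.hom ≫ q) = (A ◁ a).hom ≫ tensMk p q := by
  rw [← id_tensorHom, comp_tensMk]
  rfl

lemma tensMk_comp_left {A B D : P.FullSubcategory} {X Y : WeakModule V} (a : A ⟶ D)
    (p : D.obj ⟶ X) (q : B.obj ⟶ Y) : tensMk (a.hom ≫ p) q = (a ▷ B).hom ≫ tensMk p q := by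
  rw [← tensorHom_id, comp_tensMk]
  rfl

lemma tensMk_ext_right {X Y Z T : WeakModule V} {g h : tens P X (tens P Y Z) ⟶ T}
    (e : ∀ (A B D : P.FullSubcategory) (p : A.obj ⟶ X) (q : B.obj ⟶ Y) (r : D.obj ⟶ Z),
      tensMk p (tensMk q r) ≫ g = tensMk p (tensMk q r) ≫ h) : g = h := by
  refine tensMk_ext fun A B p q => ?_
  obtain ⟨_, _, q', r', a, rfl⟩ := exists_tensMk_lift q
  rw [tensMk_comp_right, Category.assoc, Category.assoc, e]

lemma tensMk_ext_left {X Y Z T : WeakModule V} {g h : tens P (tens P X Y) Z ⟶ T}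
    (e : ∀ (A B D : P.FullSubcategory) (p : A.obj ⟶ X) (q : B.obj ⟶ Y) (r : D.obj ⟶ Z),
      tensMk (tensMk p q) r ≫ g = tensMk (tensMk p q) r ≫ h) : g = h := by
  refine tensMk_ext fun A B p q => ?_
  obtain ⟨_, _, q', r', a, rfl⟩ := exists_tensMk_lift p
  rw [tensMk_comp_left, Category.assoc, Category.assoc, e]

lemma tens_mem (X Y : WeakModule V) : Ind P (tens P X Y) := lim_mem _

attribute [irreducible] tens

end Tensor

/-! ### Associativity -/

section Associator

/-- The direct system `α_X ⊠ (α_Y ⊠ α_Z)`. -/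
def sysR (X Y Z : WeakModule V) :
    Idx (CSub P X) (Idx (CSub P Y) (CSub P Z)) ⥤ P.FullSubcategory where
  obj W := W.fst.toC ⊗ (W.snd.fst.toC ⊗ W.snd.snd.toC)
  map h := CSub.f (le_fst (leOfHom h)) ⊗ₘ (CSub.f (le_fst (le_snd (leOfHom h))) ⊗ₘ
    CSub.f (le_snd (le_snd (leOfHom h))))
  map_id _ := by simp
  map_comp _ _ := by simp

/-- The direct system `(α_X ⊠ α_Y) ⊠ α_Z`. -/
def sysL (X Y Z : WeakModule V) :
    Idx (CSub P X) (Idx (CSub P Y) (CSub P Z)) ⥤ P.FullSubcategory where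
  obj W := (W.fst.toC ⊗ W.snd.fst.toC) ⊗ W.snd.snd.toC
  map h := (CSub.f (le_fst (leOfHom h)) ⊗ₘ CSub.f (le_fst (le_snd (leOfHom h)))) ⊗ₘ
    CSub.f (le_snd (le_snd (leOfHom h)))
  map_id _ := by simp
  map_comp _ _ := by simp

variable (P) in
/-- `lim α_X ⊠ (α_Y ⊠ α_Z)` -/
def limR (X Y Z : WeakModule V) : WeakModule V := lim (sysR (P := P) X Y Z)

variable (P) in
/-- `lim (α_X ⊠ α_Y) ⊠ α_Z` -/
def limL (X Y Z : WeakModule V) : WeakModule V := lim (sysL (P := P) X Y Z)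

variable {X Y Z : WeakModule V}

/-- The canonical morphisms into `lim α_X ⊠ (α_Y ⊠ α_Z)`. -/
def φR (W₁ : CSub P X) (W₂ : CSub P Y) (W₃ : CSub P Z) :
    (W₁.toC ⊗ (W₂.toC ⊗ W₃.toC)).obj ⟶ limR P X Y Z :=
  limφ (sysR X Y Z) ⟨W₁, ⟨W₂, W₃⟩⟩

/-- The canonical morphisms into `lim (α_X ⊠ α_Y) ⊠ α_Z`. -/
def φL (W₁ : CSub P X) (W₂ : CSub P Y) (W₃ : CSub P Z) :
    ((W₁.toC ⊗ W₂.toC) ⊗ W₃.toC).obj ⟶ limL P X Y Z :=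
  limφ (sysL X Y Z) ⟨W₁, ⟨W₂, W₃⟩⟩

section

variable {W₁ U₁ : CSub P X} {W₂ U₂ : CSub P Y} {W₃ U₃ : CSub P Z}

lemma map_φR (h₁ : W₁ ≤ U₁) (h₂ : W₂ ≤ U₂) (h₃ : W₃ ≤ U₃) :
    (CSub.f h₁ ⊗ₘ (CSub.f h₂ ⊗ₘ CSub.f h₃)).hom ≫ φR U₁ U₂ U₃ = φR W₁ W₂ W₃ :=
  map_limφ (sysR X Y Z) (i := ⟨W₁, ⟨W₂, W₃⟩⟩) (j := ⟨U₁, ⟨U₂, U₃⟩⟩)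
    (homOfLE ⟨h₁, ⟨h₂, h₃⟩⟩)

lemma map_φL (h₁ : W₁ ≤ U₁) (h₂ : W₂ ≤ U₂) (h₃ : W₃ ≤ U₃) :
    ((CSub.f h₁ ⊗ₘ CSub.f h₂) ⊗ₘ CSub.f h₃).hom ≫ φL U₁ U₂ U₃ = φL W₁ W₂ W₃ :=
  map_limφ (sysL X Y Z) (i := ⟨W₁, ⟨W₂, W₃⟩⟩) (j := ⟨U₁, ⟨U₂, U₃⟩⟩)
    (homOfLE ⟨h₁, ⟨h₂, h₃⟩⟩)

end

lemma φR_exists_rep (z : (limR P X Y Z).carrier) :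
    ∃ (W₁ : CSub P X) (W₂ : CSub P Y) (W₃ : CSub P Z)
      (w : (W₁.toC ⊗ (W₂.toC ⊗ W₃.toC)).obj.carrier), lin (φR W₁ W₂ W₃) w = z := by
  obtain ⟨i, w, h⟩ := dirLim.exists_rep (sysR (P := P) X Y Z ⋙ P.ι) z
  exact ⟨i.fst, i.snd.fst, i.snd.snd, w, h⟩

lemma φL_exists_rep (z : (limL P X Y Z).carrier) :
    ∃ (W₁ : CSub P X) (W₂ : CSub P Y) (W₃ : CSub P Z)
      (w : ((W₁.toC ⊗ W₂.toC) ⊗ W₃.toC).obj.carrier), lin (φL W₁ W₂ W₃) w = z := by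
  obtain ⟨i, w, h⟩ := dirLim.exists_rep (sysL (P := P) X Y Z ⋙ P.ι) z
  exact ⟨i.fst, i.snd.fst, i.snd.snd, w, h⟩

/-- The universal property of `lim α_X ⊠ (α_Y ⊠ α_Z)`. -/
def descR {T : WeakModule V}
    (ψ : ∀ (W₁ : CSub P X) (W₂ : CSub P Y) (W₃ : CSub P Z),
      (W₁.toC ⊗ (W₂.toC ⊗ W₃.toC)).obj ⟶ T)
    (hψ : ∀ (W₁ U₁ : CSub P X) (W₂ U₂ : CSub P Y) (W₃ U₃ : CSub P Z)
      (h₁ : W₁ ≤ U₁) (h₂ : W₂ ≤ U₂) (h₃ : W₃ ≤ U₃),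
      (CSub.f h₁ ⊗ₘ (CSub.f h₂ ⊗ₘ CSub.f h₃)).hom ≫ ψ U₁ U₂ U₃ = ψ W₁ W₂ W₃) :
    limR P X Y Z ⟶ T :=
  dirLim.desc (fun i => ψ i.fst i.snd.fst i.snd.snd)
    (fun i j h => hψ i.fst j.fst i.snd.fst j.snd.fst i.snd.snd j.snd.snd
      (le_fst (leOfHom h)) (le_fst (le_snd (leOfHom h))) (le_snd (le_snd (leOfHom h))))

/-- The universal property of `lim (α_X ⊠ α_Y) ⊠ α_Z`. -/
def descL {T : WeakModule V}
    (ψ : ∀ (W₁ : CSub P X) (W₂ : CSub P Y) (W₃ : CSub P Z),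
      ((W₁.toC ⊗ W₂.toC) ⊗ W₃.toC).obj ⟶ T)
    (hψ : ∀ (W₁ U₁ : CSub P X) (W₂ U₂ : CSub P Y) (W₃ U₃ : CSub P Z)
      (h₁ : W₁ ≤ U₁) (h₂ : W₂ ≤ U₂) (h₃ : W₃ ≤ U₃),
      ((CSub.f h₁ ⊗ₘ CSub.f h₂) ⊗ₘ CSub.f h₃).hom ≫ ψ U₁ U₂ U₃ = ψ W₁ W₂ W₃) :
    limL P X Y Z ⟶ T :=
  dirLim.desc (fun i => ψ i.fst i.snd.fst i.snd.snd)
    (fun i j h => hψ i.fst j.fst i.snd.fst j.snd.fst i.snd.snd j.snd.snd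
      (le_fst (leOfHom h)) (le_fst (le_snd (leOfHom h))) (le_snd (le_snd (leOfHom h))))

lemma φR_desc {T : WeakModule V}
    (ψ : ∀ (W₁ : CSub P X) (W₂ : CSub P Y) (W₃ : CSub P Z),
      (W₁.toC ⊗ (W₂.toC ⊗ W₃.toC)).obj ⟶ T) (hψ)
    (W₁ : CSub P X) (W₂ : CSub P Y) (W₃ : CSub P Z) :
    φR W₁ W₂ W₃ ≫ descR ψ hψ = ψ W₁ W₂ W₃ :=
  dirLim.φ_desc (α := sysR X Y Z ⋙ P.ι) _ _ ⟨W₁, ⟨W₂, W₃⟩⟩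

lemma φL_desc {T : WeakModule V}
    (ψ : ∀ (W₁ : CSub P X) (W₂ : CSub P Y) (W₃ : CSub P Z),
      ((W₁.toC ⊗ W₂.toC) ⊗ W₃.toC).obj ⟶ T) (hψ)
    (W₁ : CSub P X) (W₂ : CSub P Y) (W₃ : CSub P Z) :
    φL W₁ W₂ W₃ ≫ descL ψ hψ = ψ W₁ W₂ W₃ :=
  dirLim.φ_desc (α := sysL X Y Z ⋙ P.ι) _ _ ⟨W₁, ⟨W₂, W₃⟩⟩

lemma tensMk_i_tensφ (W₁ : CSub P X) (W₂ : CSub P Y) (W₃ : CSub P Z) :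
    tensMk (A := W₁.toC) W₁.i (tensφ W₂ W₃) = (𝟙 W₁.toC ⊗ₘ toIm (tensφ W₂ W₃)).hom ≫
      tensφ W₁ (im (tensφ W₂ W₃)) :=
  tensMk_eq (𝟙 W₁.toC) (toIm (tensφ W₂ W₃))

lemma tensMk_tensφ_i (W₁ : CSub P X) (W₂ : CSub P Y) (W₃ : CSub P Z) :
    tensMk (B := W₃.toC) (tensφ W₁ W₂) W₃.i = (toIm (tensφ W₁ W₂) ⊗ₘ 𝟙 W₃.toC).hom ≫
      tensφ (im (tensφ W₁ W₂)) W₃ :=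
  tensMk_eq (toIm (tensφ W₁ W₂)) (𝟙 W₃.toC)

variable (P X Y Z)

/-- The morphism `T_{X,(Y,Z)} : lim α_X ⊠ (α_Y ⊠ α_Z) ⟶ X ⊠̂ (Y ⊠̂ Z)`. -/
def fubiniR : limR P X Y Z ⟶ tens P X (tens P Y Z) :=
  descR (fun W₁ W₂ W₃ => (𝟙 W₁.toC ⊗ₘ toIm (tensφ W₂ W₃)).hom ≫ tensφ W₁ (im (tensφ W₂ W₃)))
    (fun W₁ U₁ W₂ U₂ W₃ U₃ h₁ h₂ h₃ => by
      rw [← tensMk_i_tensφ, ← tensMk_i_tensφ]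
      refine (comp_tensMk (CSub.f h₁) (CSub.f h₂ ⊗ₘ CSub.f h₃) U₁.i (tensφ U₂ U₃)).trans ?_
      rw [map_tensφ, CSub.f_i])

/-- The morphism `T_{(X,Y),Z} : lim (α_X ⊠ α_Y) ⊠ α_Z ⟶ (X ⊠̂ Y) ⊠̂ Z`. -/
def fubiniL : limL P X Y Z ⟶ tens P (tens P X Y) Z :=
  descL (fun W₁ W₂ W₃ => (toIm (tensφ W₁ W₂) ⊗ₘ 𝟙 W₃.toC).hom ≫ tensφ (im (tensφ W₁ W₂)) W₃)
    (fun W₁ U₁ W₂ U₂ W₃ U₃ h₁ h₂ h₃ => by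
      rw [← tensMk_tensφ_i, ← tensMk_tensφ_i]
      refine (comp_tensMk (CSub.f h₁ ⊗ₘ CSub.f h₂) (CSub.f h₃) (tensφ U₁ U₂) U₃.i).trans ?_
      rw [map_tensφ, CSub.f_i])

/-- The morphism `lim α_X ⊠ (α_Y ⊠ α_Z) ⟶ lim (α_X ⊠ α_Y) ⊠ α_Z` induced by the associativity
isomorphisms of `C`. -/
def assocHat : limR P X Y Z ⟶ limL P X Y Z :=
  descR (fun W₁ W₂ W₃ => (α_ W₁.toC W₂.toC W₃.toC).inv.hom ≫ φL W₁ W₂ W₃)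
    (fun W₁ U₁ W₂ U₂ W₃ U₃ h₁ h₂ h₃ => by
      rw [← map_φL h₁ h₂ h₃, ← Category.assoc, ← Category.assoc,
        ← ObjectProperty.FullSubcategory.comp_hom, ← ObjectProperty.FullSubcategory.comp_hom,
        associator_inv_naturality])

/-- The morphism `lim (α_X ⊠ α_Y) ⊠ α_Z ⟶ lim α_X ⊠ (α_Y ⊠ α_Z)` induced by the inverses of the
associativity isomorphisms of `C`. -/
def assocHatInv : limL P X Y Z ⟶ limR P X Y Z :=
  descL (fun W₁ W₂ W₃ => (α_ W₁.toC W₂.toC W₃.toC).hom.hom ≫ φR W₁ W₂ W₃)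
    (fun W₁ U₁ W₂ U₂ W₃ U₃ h₁ h₂ h₃ => by
      rw [← map_φR h₁ h₂ h₃, ← Category.assoc, ← Category.assoc,
        ← ObjectProperty.FullSubcategory.comp_hom, ← ObjectProperty.FullSubcategory.comp_hom,
        associator_naturality])

variable {P X Y Z}

lemma φR_fubiniR (W₁ : CSub P X) (W₂ : CSub P Y) (W₃ : CSub P Z) :
    φR W₁ W₂ W₃ ≫ fubiniR P X Y Z = tensMk (A := W₁.toC) W₁.i (tensφ W₂ W₃) := by
  rw [tensMk_i_tensφ, fubiniR, φR_desc]

lemma φL_fubiniL (W₁ : CSub P X) (W₂ : CSub P Y) (W₃ : CSub P Z) :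
    φL W₁ W₂ W₃ ≫ fubiniL P X Y Z = tensMk (B := W₃.toC) (tensφ W₁ W₂) W₃.i := by
  rw [tensMk_tensφ_i, fubiniL, φL_desc]

lemma φR_assocHat (W₁ : CSub P X) (W₂ : CSub P Y) (W₃ : CSub P Z) :
    φR W₁ W₂ W₃ ≫ assocHat P X Y Z = (α_ W₁.toC W₂.toC W₃.toC).inv.hom ≫ φL W₁ W₂ W₃ :=
  φR_desc _ _ _ _ _

lemma φL_assocHatInv (W₁ : CSub P X) (W₂ : CSub P Y) (W₃ : CSub P Z) :
    φL W₁ W₂ W₃ ≫ assocHatInv P X Y Z = (α_ W₁.toC W₂.toC W₃.toC).hom.hom ≫ φR W₁ W₂ W₃ :=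
  φL_desc _ _ _ _ _

variable (P X Y Z) in
/-- The isomorphism `lim α_X ⊠ (α_Y ⊠ α_Z) ⟶ lim (α_X ⊠ α_Y) ⊠ α_Z` induced by the associativity
isomorphisms of `C`. -/
def assocHatIso : limR P X Y Z ≅ limL P X Y Z where
  hom := assocHat P X Y Z
  inv := assocHatInv P X Y Z
  hom_inv_id := dirLim.ext fun i => by
    refine Eq.trans (b := φR i.fst i.snd.fst i.snd.snd ≫ assocHat P X Y Z ≫ assocHatInv P X Y Z)
      rfl ?_
    rw [← Category.assoc, φR_assocHat, Category.assoc, φL_assocHatInv, ← Category.assoc,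
      ← ObjectProperty.FullSubcategory.comp_hom, Iso.inv_hom_id]
    rfl
  inv_hom_id := dirLim.ext fun i => by
    refine Eq.trans (b := φL i.fst i.snd.fst i.snd.snd ≫ assocHatInv P X Y Z ≫ assocHat P X Y Z)
      rfl ?_
    rw [← Category.assoc, φL_assocHatInv, Category.assoc, φR_assocHat, ← Category.assoc,
      ← ObjectProperty.FullSubcategory.comp_hom, Iso.hom_inv_id]
    rfl

lemma fubiniR_injective : Function.Injective (lin (fubiniR P X Y Z)) := by
  refine (injective_iff_map_eq_zero _).2 fun b hb => ?_
  obtain ⟨W₁, W₂, W₃, w, rfl⟩ := φR_exists_rep b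
  -- the image of `w` in some `U₁ ⊠ U` vanishes
  have h₁ : lin (tensφ W₁ (im (tensφ W₂ W₃)))
      (lin (𝟙 W₁.toC ⊗ₘ toIm (tensφ W₂ W₃)).hom w) = 0 := by
    have := lin_congr ((φR_fubiniR W₁ W₂ W₃).trans (tensMk_i_tensφ W₁ W₂ W₃)) w
    exact this.symm.trans hb
  obtain ⟨U₁, U, t₁, t₂, ht⟩ := tens_exists_eq_zero h₁
  let c : W₂.toC ⊗ W₃.toC ⟶ U.toC := toIm (tensφ W₂ W₃) ≫ CSub.f t₂
  have hc : c.hom ≫ U.i = tensφ W₂ W₃ := toIm_i (tensφ W₂ W₃)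
  have h₂ : lin (CSub.f t₁ ⊗ₘ c).hom w = 0 := by
    have : CSub.f t₁ ⊗ₘ c = (𝟙 W₁.toC ⊗ₘ toIm (tensφ W₂ W₃)) ≫ (CSub.f t₁ ⊗ₘ CSub.f t₂) := by
      rw [tensorHom_comp_tensorHom, Category.id_comp]
    rw [this]
    exact ht
  -- factor the inclusion of `U` through some `U₂ ⊠ U₃`
  obtain ⟨U₂, U₃, d, hd⟩ := exists_tens_lift (A := U.toC) U.i
  obtain ⟨W₂', hW₂, hU₂⟩ := exists_ge_ge W₂ U₂
  obtain ⟨W₃', hW₃, hU₃⟩ := exists_ge_ge W₃ U₃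
  obtain ⟨Z₂, Z₃, s₂, s₃, hs⟩ := eq_of_tensφ (W := W₂') (W' := W₃')
    (c ≫ d ≫ (CSub.f hU₂ ⊗ₘ CSub.f hU₃)) (CSub.f hW₂ ⊗ₘ CSub.f hW₃) (by
      rw [map_tensφ]
      simp only [ObjectProperty.FullSubcategory.comp_hom, Category.assoc]
      rw [map_tensφ, ← hd, hc])
  have h₃ : (CSub.f t₁ ⊗ₘ (CSub.f (hW₂.trans s₂) ⊗ₘ CSub.f (hW₃.trans s₃)) :
      W₁.toC ⊗ (W₂.toC ⊗ W₃.toC) ⟶ _) = (CSub.f t₁ ⊗ₘ c) ≫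
        (𝟙 _ ⊗ₘ ((d ≫ (CSub.f hU₂ ⊗ₘ CSub.f hU₃)) ≫ (CSub.f s₂ ⊗ₘ CSub.f s₃))) := by
    rw [tensorHom_comp_tensorHom, Category.comp_id, ← Category.assoc, hs,
      tensorHom_comp_tensorHom, CSub.f_f, CSub.f_f]
  have h₄ : lin (CSub.f t₁ ⊗ₘ (CSub.f (hW₂.trans s₂) ⊗ₘ CSub.f (hW₃.trans s₃)) :
      W₁.toC ⊗ (W₂.toC ⊗ W₃.toC) ⟶ _).hom w = 0 := by
    rw [h₃]
    exact (congrArg (lin _) h₂).trans (map_zero (lin _))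
  exact (lin_congr (map_φR t₁ (hW₂.trans s₂) (hW₃.trans s₃)) w).symm.trans
    ((congrArg (lin (φR _ _ _)) h₄).trans (map_zero (lin _)))

lemma fubiniR_surjective : Function.Surjective (lin (fubiniR P X Y Z)) := by
  intro b
  obtain ⟨W, U, w, rfl⟩ := tens_exists_rep b
  obtain ⟨U₂, U₃, d, hd⟩ := exists_tens_lift (A := U.toC) U.i
  have h : tensφ W U = (𝟙 W.toC ⊗ₘ d).hom ≫ φR W U₂ U₃ ≫ fubiniR P X Y Z := by
    rw [φR_fubiniR]
    refine Eq.trans ?_ (comp_tensMk (𝟙 W.toC) d W.i (tensφ U₂ U₃)).symm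
    rw [← hd, ← tensMk_i]
    rfl
  exact ⟨lin (φR W U₂ U₃) (lin (𝟙 W.toC ⊗ₘ d).hom w), (lin_congr h w).symm⟩

lemma fubiniL_injective : Function.Injective (lin (fubiniL P X Y Z)) := by
  refine (injective_iff_map_eq_zero _).2 fun b hb => ?_
  obtain ⟨W₂, W₃, W₁, w, rfl⟩ := φL_exists_rep b
  have h₁ : lin (tensφ (im (tensφ W₂ W₃)) W₁)
      (lin (toIm (tensφ W₂ W₃) ⊗ₘ 𝟙 W₁.toC).hom w) = 0 := by
    have := lin_congr ((φL_fubiniL W₂ W₃ W₁).trans (tensMk_tensφ_i W₂ W₃ W₁)) w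
    exact this.symm.trans hb
  obtain ⟨U, U₁, t₂, t₁, ht⟩ := tens_exists_eq_zero h₁
  let c : W₂.toC ⊗ W₃.toC ⟶ U.toC := toIm (tensφ W₂ W₃) ≫ CSub.f t₂
  have hc : c.hom ≫ U.i = tensφ W₂ W₃ := toIm_i (tensφ W₂ W₃)
  have h₂ : lin (c ⊗ₘ CSub.f t₁).hom w = 0 := by
    have : c ⊗ₘ CSub.f t₁ = (toIm (tensφ W₂ W₃) ⊗ₘ 𝟙 W₁.toC) ≫ (CSub.f t₂ ⊗ₘ CSub.f t₁) := by
      rw [tensorHom_comp_tensorHom, Category.id_comp]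
    rw [this]
    exact ht
  obtain ⟨U₂, U₃, d, hd⟩ := exists_tens_lift (A := U.toC) U.i
  obtain ⟨W₂', hW₂, hU₂⟩ := exists_ge_ge W₂ U₂
  obtain ⟨W₃', hW₃, hU₃⟩ := exists_ge_ge W₃ U₃
  obtain ⟨Z₂, Z₃, s₂, s₃, hs⟩ := eq_of_tensφ (W := W₂') (W' := W₃')
    (c ≫ d ≫ (CSub.f hU₂ ⊗ₘ CSub.f hU₃)) (CSub.f hW₂ ⊗ₘ CSub.f hW₃) (by
      rw [map_tensφ]
      simp only [ObjectProperty.FullSubcategory.comp_hom, Category.assoc]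
      rw [map_tensφ, ← hd, hc])
  have h₃ : ((CSub.f (hW₂.trans s₂) ⊗ₘ CSub.f (hW₃.trans s₃)) ⊗ₘ CSub.f t₁ :
      (W₂.toC ⊗ W₃.toC) ⊗ W₁.toC ⟶ _) = (c ⊗ₘ CSub.f t₁) ≫
        (((d ≫ (CSub.f hU₂ ⊗ₘ CSub.f hU₃)) ≫ (CSub.f s₂ ⊗ₘ CSub.f s₃)) ⊗ₘ 𝟙 _) := by
    rw [tensorHom_comp_tensorHom, Category.comp_id, ← Category.assoc, hs,
      tensorHom_comp_tensorHom, CSub.f_f, CSub.f_f]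
  have h₄ : lin ((CSub.f (hW₂.trans s₂) ⊗ₘ CSub.f (hW₃.trans s₃)) ⊗ₘ CSub.f t₁ :
      (W₂.toC ⊗ W₃.toC) ⊗ W₁.toC ⟶ _).hom w = 0 := by
    rw [h₃]
    exact (congrArg (lin _) h₂).trans (map_zero (lin _))
  exact (lin_congr (map_φL (hW₂.trans s₂) (hW₃.trans s₃) t₁) w).symm.trans
    ((congrArg (lin (φL _ _ _)) h₄).trans (map_zero (lin _)))

lemma fubiniL_surjective : Function.Surjective (lin (fubiniL P X Y Z)) := by
  intro b
  obtain ⟨U, W, w, rfl⟩ := tens_exists_rep b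
  obtain ⟨U₂, U₃, d, hd⟩ := exists_tens_lift (A := U.toC) U.i
  have h : tensφ U W = (d ⊗ₘ 𝟙 W.toC).hom ≫ φL U₂ U₃ W ≫ fubiniL P X Y Z := by
    rw [φL_fubiniL]
    refine Eq.trans ?_ (comp_tensMk d (𝟙 W.toC) (tensφ U₂ U₃) W.i).symm
    rw [← hd, ← tensMk_i]
    rfl
  exact ⟨lin (φL U₂ U₃ W) (lin (d ⊗ₘ 𝟙 W.toC).hom w), (lin_congr h w).symm⟩

instance : IsIso (fubiniR P X Y Z) :=
  isIso_of_bijective _ fubiniR_injective fubiniR_surjective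

instance : IsIso (fubiniL P X Y Z) :=
  isIso_of_bijective _ fubiniL_injective fubiniL_surjective

variable (P X Y Z) in
/-- The associativity isomorphism `X ⊠̂ (Y ⊠̂ Z) ⟶ (X ⊠̂ Y) ⊠̂ Z`. -/
def tensAssoc : tens P X (tens P Y Z) ≅ tens P (tens P X Y) Z :=
  (asIso (fubiniR P X Y Z)).symm ≪≫ assocHatIso P X Y Z ≪≫ asIso (fubiniL P X Y Z)

lemma tensMk_assoc_i (W₁ : CSub P X) (W₂ : CSub P Y) (W₃ : CSub P Z) :
    tensMk (A := W₁.toC) W₁.i (tensφ W₂ W₃) ≫ (tensAssoc P X Y Z).hom =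
      (α_ W₁.toC W₂.toC W₃.toC).inv.hom ≫ tensMk (B := W₃.toC) (tensφ W₁ W₂) W₃.i := by
  rw [← φR_fubiniR, ← φL_fubiniL]
  simp only [tensAssoc, Iso.trans_hom, Iso.symm_hom, asIso_inv, asIso_hom,
    Category.assoc, IsIso.hom_inv_id_assoc]
  rw [← Category.assoc, ← Category.assoc]
  exact congrArg (· ≫ _) (φR_assocHat W₁ W₂ W₃)

lemma tensMk_assoc_hom {A B D : P.FullSubcategory} (p : A.obj ⟶ X) (q : B.obj ⟶ Y) (r : D.obj ⟶ Z) :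
    tensMk p (tensMk q r) ≫ (tensAssoc P X Y Z).hom = (α_ A B D).inv.hom ≫ tensMk (tensMk p q) r := by
  have h₁ : tensMk p (tensMk q r) = (toIm p ⊗ₘ (toIm q ⊗ₘ toIm r)).hom ≫
      tensMk (A := (im p).toC) (im p).i (tensφ (im q) (im r)) := by
    rw [comp_tensMk]
    rfl
  have h₂ : tensMk (tensMk p q) r = ((toIm p ⊗ₘ toIm q) ⊗ₘ toIm r).hom ≫
      tensMk (B := (im r).toC) (tensφ (im p) (im q)) (im r).i := by
    rw [comp_tensMk]
    rfl
  rw [h₁, h₂, Category.assoc, tensMk_assoc_i, ← Category.assoc, ← Category.assoc]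
  exact congrArg (· ≫ _) (hom_congr (associator_inv_naturality (toIm p) (toIm q) (toIm r)))

lemma tensMk_assoc_inv {A B D : P.FullSubcategory} (p : A.obj ⟶ X) (q : B.obj ⟶ Y) (r : D.obj ⟶ Z) :
    tensMk (tensMk p q) r ≫ (tensAssoc P X Y Z).inv = (α_ A B D).hom.hom ≫ tensMk p (tensMk q r) := by
  rw [Iso.comp_inv_eq, Category.assoc, tensMk_assoc_hom, ← Category.assoc,
    ← ObjectProperty.FullSubcategory.comp_hom, Iso.hom_inv_id]
  rfl

lemma tensMk_assoc_inv_assoc {A B D : P.FullSubcategory} (p : A.obj ⟶ X) (q : B.obj ⟶ Y)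
    (r : D.obj ⟶ Z) {T : WeakModule V} (k : tens P X (tens P Y Z) ⟶ T) :
    tensMk (tensMk p q) r ≫ (tensAssoc P X Y Z).inv ≫ k = (α_ A B D).hom.hom ≫ tensMk p (tensMk q r) ≫ k := by
  rw [← Category.assoc, tensMk_assoc_inv, Category.assoc]

end Associator

/-! ### The unit isomorphisms -/

section Unitors

variable (P) in
/-- The unit object, which is `V` as soon as the unit object of `C` is `V`. -/
abbrev unit : WeakModule V := (𝟙_ P.FullSubcategory).obj

variable (P) in
/-- The morphism `V ⊠̂ X ⟶ X` which restricts to `U ⊠ W ⟶ V ⊠ W ⟶ W ⟶ X` for `U ⊆ V` and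
`W ⊆ X`. -/
def leftHom (X : WeakModule V) : tens P (unit P) X ⟶ X :=
  tensDesc (fun U W => ((ObjectProperty.homMk U.i : U.toC ⟶ 𝟙_ _) ▷ W.toC).hom ≫
      (λ_ W.toC).hom.hom ≫ W.i)
    (fun W U W' U' h h' => by
      have : (CSub.f h ⊗ₘ CSub.f h') ≫ ((ObjectProperty.homMk U.i : U.toC ⟶ 𝟙_ _) ▷ U'.toC) ≫
          (λ_ U'.toC).hom =
          ((ObjectProperty.homMk W.i : W.toC ⟶ 𝟙_ _) ▷ W'.toC) ≫ (λ_ W'.toC).hom ≫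
            CSub.f h' := by
        rw [← leftUnitor_naturality, ← tensorHom_id, ← tensorHom_id, ← id_tensorHom,
          tensorHom_comp_tensorHom_assoc, tensorHom_comp_tensorHom_assoc, Category.comp_id,
          Category.id_comp]
        rfl
      have h₂ := congrArg (fun g => g ≫ U'.i) (hom_congr this)
      simpa only [ObjectProperty.FullSubcategory.comp_hom, Category.assoc, CSub.f_i] using h₂)

variable (P) in
/-- The morphism `X ⊠̂ V ⟶ X` which restricts to `W ⊠ U ⟶ W ⊠ V ⟶ W ⟶ X` for `U ⊆ V` and
`W ⊆ X`. -/
def rightHom (X : WeakModule V) : tens P X (unit P) ⟶ X :=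
  tensDesc (fun W U => (W.toC ◁ (ObjectProperty.homMk U.i : U.toC ⟶ 𝟙_ _)).hom ≫
      (ρ_ W.toC).hom.hom ≫ W.i)
    (fun W' U' W U h' h => by
      have : (CSub.f h' ⊗ₘ CSub.f h) ≫ (U'.toC ◁ (ObjectProperty.homMk U.i : U.toC ⟶ 𝟙_ _)) ≫
          (ρ_ U'.toC).hom =
          (W'.toC ◁ (ObjectProperty.homMk W.i : W.toC ⟶ 𝟙_ _)) ≫ (ρ_ W'.toC).hom ≫
            CSub.f h' := by
        rw [← rightUnitor_naturality, ← id_tensorHom, ← id_tensorHom, ← tensorHom_id,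
          tensorHom_comp_tensorHom_assoc, tensorHom_comp_tensorHom_assoc, Category.comp_id,
          Category.id_comp]
        rfl
      have h₂ := congrArg (fun g => g ≫ U'.i) (hom_congr this)
      simpa only [ObjectProperty.FullSubcategory.comp_hom, Category.assoc, CSub.f_i] using h₂)

variable {X Y : WeakModule V}

lemma tensφ_leftHom (U : CSub P (unit P)) (W : CSub P X) :
    tensφ U W ≫ leftHom P X =
      ((ObjectProperty.homMk U.i : U.toC ⟶ 𝟙_ _) ▷ W.toC).hom ≫ (λ_ W.toC).hom.hom ≫ W.i :=
  tensφ_desc _ _ _ _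

lemma tensφ_rightHom (W : CSub P X) (U : CSub P (unit P)) :
    tensφ W U ≫ rightHom P X =
      (W.toC ◁ (ObjectProperty.homMk U.i : U.toC ⟶ 𝟙_ _)).hom ≫ (ρ_ W.toC).hom.hom ≫ W.i :=
  tensφ_desc _ _ _ _

lemma tensMk_leftHom {A B : P.FullSubcategory} (a : A ⟶ 𝟙_ _) (p : B.obj ⟶ X) :
    tensMk a.hom p ≫ leftHom P X = (a ▷ B).hom ≫ (λ_ B).hom.hom ≫ p := by
  have : (toIm a.hom ⊗ₘ toIm p) ≫
      ((ObjectProperty.homMk (im a.hom).i : (im a.hom).toC ⟶ 𝟙_ _) ▷ (im p).toC) ≫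
        (λ_ (im p).toC).hom = a ▷ B ≫ (λ_ B).hom ≫ toIm p := by
    rw [← leftUnitor_naturality, ← tensorHom_id, ← tensorHom_id, ← id_tensorHom,
      tensorHom_comp_tensorHom_assoc, tensorHom_comp_tensorHom_assoc, Category.comp_id,
      Category.id_comp, Category.comp_id]
    rfl
  rw [tensMk, Category.assoc, tensφ_leftHom]
  have h₂ := congrArg (fun g => g ≫ (im p).i) (hom_congr this)
  simpa only [ObjectProperty.FullSubcategory.comp_hom, Category.assoc, toIm_i] using h₂

lemma tensMk_rightHom {A B : P.FullSubcategory} (p : B.obj ⟶ X) (a : A ⟶ 𝟙_ _) :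
    tensMk p a.hom ≫ rightHom P X = (B ◁ a).hom ≫ (ρ_ B).hom.hom ≫ p := by
  have : (toIm p ⊗ₘ toIm a.hom) ≫
      ((im p).toC ◁ (ObjectProperty.homMk (im a.hom).i : (im a.hom).toC ⟶ 𝟙_ _)) ≫
        (ρ_ (im p).toC).hom = B ◁ a ≫ (ρ_ B).hom ≫ toIm p := by
    rw [← rightUnitor_naturality, ← id_tensorHom, ← id_tensorHom, ← tensorHom_id,
      tensorHom_comp_tensorHom_assoc, tensorHom_comp_tensorHom_assoc, Category.comp_id,
      Category.id_comp, Category.comp_id]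
    rfl
  rw [tensMk, Category.assoc, tensφ_rightHom]
  have h₂ := congrArg (fun g => g ≫ (im p).i) (hom_congr this)
  simpa only [ObjectProperty.FullSubcategory.comp_hom, Category.assoc, toIm_i] using h₂

lemma iso_hom_hom_injective {A B : P.FullSubcategory} (e : A ≅ B) :
    Function.Injective (lin e.hom.hom) :=
  Function.LeftInverse.injective (g := lin e.inv.hom) fun a =>
    lin_congr (hom_congr e.hom_inv_id) a

lemma leftHom_isIso (hX : Ind P X) : IsIso (leftHom P X) := by
  refine isIso_of_bijective _ ((injective_iff_map_eq_zero _).2 fun z hz => ?_) fun x => ?_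
  · obtain ⟨U, W, w, rfl⟩ := tens_exists_rep z
    have h₁ : tensφ U W = ((ObjectProperty.homMk U.i : U.toC ⟶ 𝟙_ _) ▷ W.toC).hom ≫
        tensMk (B := W.toC) (𝟙 _) W.i := by
      rw [← tensMk_comp_left, ← tensMk_i, Category.comp_id]
      rfl
    have h₂ := (lin_congr (tensφ_leftHom U W) w).symm.trans hz
    have h₃ : lin ((ObjectProperty.homMk U.i : U.toC ⟶ 𝟙_ _) ▷ W.toC).hom w = 0 := by
      apply iso_hom_hom_injective (λ_ W.toC)
      apply W.i_injective
      rw [map_zero, map_zero]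
      exact h₂
    rw [h₁]
    exact (congrArg (lin (tensMk _ _)) h₃).trans (map_zero (lin _))
  · obtain ⟨W, w, rfl⟩ := exists_mem hX x
    have h₁ := tensMk_leftHom (𝟙 (𝟙_ P.FullSubcategory)) (B := W.toC) W.i
    have h₂ : (λ_ W.toC).inv.hom ≫ tensMk (𝟙 (𝟙_ P.FullSubcategory) : _ ⟶ _).hom W.i ≫
        leftHom P X = W.i := by
      rw [h₁, id_whiskerRight, ← Category.assoc, ← Category.assoc,
        ← ObjectProperty.FullSubcategory.comp_hom, ← ObjectProperty.FullSubcategory.comp_hom,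
        Category.comp_id, Iso.inv_hom_id]
      rfl
    exact ⟨lin (tensMk (𝟙 (𝟙_ P.FullSubcategory) : _ ⟶ _).hom W.i) (lin (λ_ W.toC).inv.hom w),
      lin_congr h₂ w⟩

lemma rightHom_isIso (hX : Ind P X) : IsIso (rightHom P X) := by
  refine isIso_of_bijective _ ((injective_iff_map_eq_zero _).2 fun z hz => ?_) fun x => ?_
  · obtain ⟨W, U, w, rfl⟩ := tens_exists_rep z
    have h₁ : tensφ W U = (W.toC ◁ (ObjectProperty.homMk U.i : U.toC ⟶ 𝟙_ _)).hom ≫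
        tensMk (A := W.toC) W.i (𝟙 _) := by
      rw [← tensMk_comp_right, ← tensMk_i, Category.comp_id]
      rfl
    have h₂ := (lin_congr (tensφ_rightHom W U) w).symm.trans hz
    have h₃ : lin (W.toC ◁ (ObjectProperty.homMk U.i : U.toC ⟶ 𝟙_ _)).hom w = 0 := by
      apply iso_hom_hom_injective (ρ_ W.toC)
      apply W.i_injective
      rw [map_zero, map_zero]
      exact h₂
    rw [h₁]
    exact (congrArg (lin (tensMk _ _)) h₃).trans (map_zero (lin _))
  · obtain ⟨W, w, rfl⟩ := exists_mem hX x
    have h₁ := tensMk_rightHom (B := W.toC) W.i (𝟙 (𝟙_ P.FullSubcategory))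
    have h₂ : (ρ_ W.toC).inv.hom ≫ tensMk W.i (𝟙 (𝟙_ P.FullSubcategory) : _ ⟶ _).hom ≫
        rightHom P X = W.i := by
      rw [h₁, whiskerLeft_id, ← Category.assoc, ← Category.assoc,
        ← ObjectProperty.FullSubcategory.comp_hom, ← ObjectProperty.FullSubcategory.comp_hom,
        Category.comp_id, Iso.inv_hom_id]
      rfl
    exact ⟨lin (tensMk W.i (𝟙 (𝟙_ P.FullSubcategory) : _ ⟶ _).hom) (lin (ρ_ W.toC).inv.hom w),
      lin_congr h₂ w⟩

end Unitors

/-! ### The braiding -/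

section Braiding

variable [BraidedCategory P.FullSubcategory]

variable (P) in
/-- The morphism `X ⊠̂ Y ⟶ Y ⊠̂ X` induced by the braiding of `C`. -/
def braidHom (X Y : WeakModule V) : tens P X Y ⟶ tens P Y X :=
  tensDesc (fun W W' => (β_ W.toC W'.toC).hom.hom ≫ tensφ W' W)
    (fun W U W' U' h h' => by
      rw [← map_tensφ h' h, ← Category.assoc, ← Category.assoc,
        ← ObjectProperty.FullSubcategory.comp_hom, ← ObjectProperty.FullSubcategory.comp_hom,
        BraidedCategory.braiding_naturality])

variable (P) in
/-- The morphism `Y ⊠̂ X ⟶ X ⊠̂ Y` induced by the inverse of the braiding of `C`. -/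
def braidInv (X Y : WeakModule V) : tens P Y X ⟶ tens P X Y :=
  tensDesc (fun W' W => (β_ W.toC W'.toC).inv.hom ≫ tensφ W W')
    (fun W' U' W U h' h => by
      rw [← map_tensφ h h', ← Category.assoc, ← Category.assoc,
        ← ObjectProperty.FullSubcategory.comp_hom, ← ObjectProperty.FullSubcategory.comp_hom,
        BraidedCategory.braiding_inv_naturality])

variable {X Y : WeakModule V}

lemma tensφ_braidHom (W : CSub P X) (W' : CSub P Y) :
    tensφ W W' ≫ braidHom P X Y = (β_ W.toC W'.toC).hom.hom ≫ tensφ W' W :=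
  tensφ_desc _ _ _ _

lemma tensφ_braidInv (W : CSub P X) (W' : CSub P Y) :
    tensφ W' W ≫ braidInv P X Y = (β_ W.toC W'.toC).inv.hom ≫ tensφ W W' :=
  tensφ_desc _ _ _ _

variable (P X Y) in
/-- The braiding isomorphism `X ⊠̂ Y ⟶ Y ⊠̂ X` induced by the braiding of `C`. -/
def tensBraid : tens P X Y ≅ tens P Y X where
  hom := braidHom P X Y
  inv := braidInv P X Y
  hom_inv_id := tens_ext fun W W' => by
    rw [← Category.assoc, tensφ_braidHom, Category.assoc, tensφ_braidInv, ← Category.assoc,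
      ← ObjectProperty.FullSubcategory.comp_hom, Iso.hom_inv_id]
    rfl
  inv_hom_id := tens_ext fun W' W => by
    rw [← Category.assoc, tensφ_braidInv, Category.assoc, tensφ_braidHom, ← Category.assoc,
      ← ObjectProperty.FullSubcategory.comp_hom, Iso.inv_hom_id]
    rfl

lemma tensMk_braid {A B : P.FullSubcategory} (p : A.obj ⟶ X) (q : B.obj ⟶ Y) :
    tensMk p q ≫ (tensBraid P X Y).hom = (β_ A B).hom.hom ≫ tensMk q p := by
  rw [tensMk, Category.assoc, show (tensBraid P X Y).hom = braidHom P X Y from rfl, tensφ_braidHom,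
    tensMk, ← Category.assoc, ← Category.assoc,
    ← ObjectProperty.FullSubcategory.comp_hom, ← ObjectProperty.FullSubcategory.comp_hom,
    BraidedCategory.braiding_naturality]

lemma tensMk_braid_assoc {A B : P.FullSubcategory} (p : A.obj ⟶ X) (q : B.obj ⟶ Y)
    {T : WeakModule V} (k : tens P Y X ⟶ T) :
    tensMk p q ≫ (tensBraid P X Y).hom ≫ k = (β_ A B).hom.hom ≫ tensMk q p ≫ k := by
  rw [← Category.assoc, tensMk_braid, Category.assoc]

end Braiding

/-! ### The twist -/

section Twist

/-- A twist on a braided monoidal category: a natural automorphism `θ` of the identity functor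
with `θ_𝟙 = id` which satisfies the balancing equation
`θ_{X ⊗ Y} = β_{Y,X} ∘ β_{X,Y} ∘ (θ_X ⊗ θ_Y)`. -/
structure Twist (C : Type*) [Category C] [MonoidalCategory C] [BraidedCategory C] where
  iso : 𝟭 C ≅ 𝟭 C
  unit : iso.hom.app (𝟙_ C) = 𝟙 (𝟙_ C)
  balancing : ∀ X Y : C, iso.hom.app (X ⊗ Y) =
    (iso.hom.app X ⊗ₘ iso.hom.app Y) ≫ (β_ X Y).hom ≫ (β_ Y X).hom

end Twist


/-! ### The braided monoidal category `Ind(C)` -/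

section Ind

lemma ind_ext {X Y : (Ind P).FullSubcategory} {g h : X ⟶ Y} (e : g.hom = h.hom) : g = h :=
  ObjectProperty.hom_ext _ e

/-- The tensor product, the unit object, and the associativity and unit isomorphisms of
`Ind(C)`. The associator of a monoidal category in Mathlib goes from `(X ⊗ Y) ⊗ Z` to
`X ⊗ (Y ⊗ Z)`. -/
instance indStruct : MonoidalCategoryStruct (Ind P).FullSubcategory where
  tensorObj X Y := ⟨tens P X.obj Y.obj, tens_mem _ _⟩
  whiskerLeft X _ _ G := ObjectProperty.homMk (tensMap (𝟙 X.obj) G.hom)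
  whiskerRight F Y := ObjectProperty.homMk (tensMap F.hom (𝟙 Y.obj))
  tensorHom F G := ObjectProperty.homMk (tensMap F.hom G.hom)
  tensorUnit := ⟨unit P, le_Ind _ (𝟙_ P.FullSubcategory).property⟩
  associator X Y Z := (Ind P).isoMk (tensAssoc P X.obj Y.obj Z.obj).symm
  leftUnitor X := (Ind P).isoMk
    (letI := leftHom_isIso X.property; asIso (leftHom P X.obj))
  rightUnitor X := (Ind P).isoMk
    (letI := rightHom_isIso X.property; asIso (rightHom P X.obj))

variable {X Y Z T : WeakModule V}

lemma tensMk_ext_left₂ {S : WeakModule V} {g h : tens P (tens P (tens P X Y) Z) T ⟶ S}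
    (e : ∀ (A B D E : P.FullSubcategory) (p : A.obj ⟶ X) (q : B.obj ⟶ Y) (r : D.obj ⟶ Z)
      (s : E.obj ⟶ T), tensMk (tensMk (tensMk p q) r) s ≫ g = tensMk (tensMk (tensMk p q) r) s ≫ h) : g = h := by
  refine tensMk_ext_left fun A B D p q r => ?_
  obtain ⟨_, _, p', q', a, rfl⟩ := exists_tensMk_lift p
  rw [tensMk_comp_left, tensMk_comp_left, Category.assoc, Category.assoc, e]

lemma tensMap_id : tensMap (𝟙 X) (𝟙 Y) = 𝟙 (tens P X Y) :=
  tensMk_ext fun A B p q => by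
    rw [tensMk_map, Category.comp_id, Category.comp_id, Category.comp_id]

lemma tensMap_comp {X' Y' X'' Y'' : WeakModule V} (F : X ⟶ X') (G : Y ⟶ Y') (F' : X' ⟶ X'')
    (G' : Y' ⟶ Y'') :
    tensMap (P := P) F G ≫ tensMap F' G' = tensMap (F ≫ F') (G ≫ G') :=
  tensMk_ext fun A B p q => by
    rw [tensMk_map_assoc, tensMk_map, tensMk_map, Category.assoc, Category.assoc]

lemma assoc_naturality {X' Y' Z' : WeakModule V} (F : X ⟶ X') (G : Y ⟶ Y') (H : Z ⟶ Z') :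
    tensMap (tensMap F G) H ≫ (tensAssoc P X' Y' Z').inv =
      (tensAssoc P X Y Z).inv ≫ tensMap F (tensMap G H) :=
  tensMk_ext_left fun A B D p q r => by
    rw [tensMk_map_assoc, tensMk_map, tensMk_assoc_inv, tensMk_assoc_inv_assoc, tensMk_map, tensMk_map]

lemma leftHom_naturality (F : X ⟶ Y) :
    tensMap (𝟙 (unit P)) F ≫ leftHom P Y = leftHom P X ≫ F :=
  tensMk_ext fun A B p q => by
    have h := tensMk_leftHom (ObjectProperty.homMk p : A ⟶ 𝟙_ _) q
    have h' := tensMk_leftHom (ObjectProperty.homMk p : A ⟶ 𝟙_ _) (q ≫ F)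
    rw [tensMk_map_assoc, Category.comp_id]
    refine h'.trans ?_
    rw [← Category.assoc (tensMk p q)]
    refine Eq.trans ?_ (congrArg (· ≫ F) h).symm
    simp only [Category.assoc]

lemma rightHom_naturality (F : X ⟶ Y) :
    tensMap F (𝟙 (unit P)) ≫ rightHom P Y = rightHom P X ≫ F :=
  tensMk_ext fun A B q p => by
    have h := tensMk_rightHom q (ObjectProperty.homMk p : B ⟶ 𝟙_ _)
    have h' := tensMk_rightHom (q ≫ F) (ObjectProperty.homMk p : B ⟶ 𝟙_ _)
    rw [tensMk_map_assoc, Category.comp_id]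
    refine h'.trans ?_
    rw [← Category.assoc (tensMk q p)]
    refine Eq.trans ?_ (congrArg (· ≫ F) h).symm
    simp only [Category.assoc]

lemma assoc_pentagon :
    tensMap (tensAssoc P X Y Z).inv (𝟙 T) ≫ (tensAssoc P X (tens P Y Z) T).inv ≫
        tensMap (𝟙 X) (tensAssoc P Y Z T).inv =
      (tensAssoc P (tens P X Y) Z T).inv ≫ (tensAssoc P X Y (tens P Z T)).inv :=
  tensMk_ext_left₂ fun A B D E p q r s => by
    have h := hom_congr (pentagon A B D E)
    simp only [ObjectProperty.FullSubcategory.comp_hom] at h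
    rw [tensMk_map_assoc, tensMk_assoc_inv, Category.comp_id, tensMk_comp_left, Category.assoc,
      tensMk_assoc_inv_assoc, tensMk_map, tensMk_assoc_inv, Category.comp_id, tensMk_comp_right,
      tensMk_assoc_inv_assoc, tensMk_assoc_inv]
    simp only [← Category.assoc] at h ⊢
    rw [h]

lemma assoc_triangle :
    (tensAssoc P X (unit P) Y).inv ≫ tensMap (𝟙 X) (leftHom P Y) =
      tensMap (rightHom P X) (𝟙 Y) :=
  tensMk_ext_left fun A B D p q r => by
    have h := hom_congr (triangle A D)
    have hl := tensMk_leftHom (ObjectProperty.homMk q : B ⟶ 𝟙_ _) r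
    have hr := tensMk_rightHom p (ObjectProperty.homMk q : B ⟶ 𝟙_ _)
    simp only [ObjectProperty.homMk_hom] at hl hr
    rw [tensMk_assoc_inv_assoc, tensMk_map, tensMk_map, hl, hr, Category.comp_id, Category.comp_id,
      tensMk_comp_right, tensMk_comp_right, tensMk_comp_left, tensMk_comp_left]
    simp only [← Category.assoc]
    refine congrArg (· ≫ _) ?_
    simp only [← ObjectProperty.FullSubcategory.comp_hom]
    refine hom_congr ?_
    simp

/-- The monoidal category `Ind(C)`. -/
instance indMonoidal : MonoidalCategory (Ind P).FullSubcategory :=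
  MonoidalCategory.ofTensorHom
    (fun _ _ => ind_ext tensMap_id)
    (fun _ _ _ _ => rfl)
    (fun _ _ => rfl)
    (fun _ _ _ _ => ind_ext (tensMap_comp _ _ _ _))
    (fun _ _ _ => ind_ext (assoc_naturality _ _ _))
    (fun _ => ind_ext (leftHom_naturality _))
    (fun _ => ind_ext (rightHom_naturality _))
    (fun _ _ _ _ => ind_ext assoc_pentagon)
    (fun _ _ => ind_ext assoc_triangle)

section Linear

variable [MonoidalPreadditive P.FullSubcategory]

lemma exists_common {A B : P.FullSubcategory} (p : A.obj ⟶ X) (q : B.obj ⟶ X) :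
    ∃ (W : CSub P X) (a : A ⟶ W.toC) (b : B ⟶ W.toC), p = a.hom ≫ W.i ∧ q = b.hom ≫ W.i := by
  obtain ⟨W, h, h'⟩ := exists_ge₂ X (im p) (im q)
  exact ⟨W, toIm p ≫ CSub.f h, toIm q ≫ CSub.f h', rfl, rfl⟩

lemma tensMk_add_right {A B : P.FullSubcategory} (p : A.obj ⟶ X) (q q' : B.obj ⟶ Y) :
    tensMk p (q + q') = tensMk p q + tensMk p q' := by
  obtain ⟨W, a, b, rfl, rfl⟩ := exists_common q q'
  have h : a.hom ≫ W.i + b.hom ≫ W.i = (a + b).hom ≫ W.i :=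
    (Preadditive.add_comp _ _ _ _ _ _).symm
  rw [h, tensMk_comp_right, tensMk_comp_right, tensMk_comp_right, MonoidalPreadditive.whiskerLeft_add]
  exact Preadditive.add_comp _ _ _ _ _ _

lemma tensMk_add_left {A B : P.FullSubcategory} (p p' : A.obj ⟶ X) (q : B.obj ⟶ Y) :
    tensMk (p + p') q = tensMk p q + tensMk p' q := by
  obtain ⟨W, a, b, rfl, rfl⟩ := exists_common p p'
  have h : a.hom ≫ W.i + b.hom ≫ W.i = (a + b).hom ≫ W.i :=
    (Preadditive.add_comp _ _ _ _ _ _).symm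
  rw [h, tensMk_comp_left, tensMk_comp_left, tensMk_comp_left, MonoidalPreadditive.add_whiskerRight]
  exact Preadditive.add_comp _ _ _ _ _ _

lemma tensMap_add_right {X' Y' : WeakModule V} (F : X ⟶ X') (G G' : Y ⟶ Y') :
    tensMap (P := P) F (G + G') = tensMap F G + tensMap F G' :=
  tensMk_ext fun A B p q => by
    rw [tensMk_map, Preadditive.comp_add, Preadditive.comp_add, tensMk_map, tensMk_map, tensMk_add_right]

lemma tensMap_add_left {X' Y' : WeakModule V} (F F' : X ⟶ X') (G : Y ⟶ Y') :
    tensMap (P := P) (F + F') G = tensMap F G + tensMap F' G :=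
  tensMk_ext fun A B p q => by
    rw [tensMk_map, Preadditive.comp_add, Preadditive.comp_add, tensMk_map, tensMk_map, tensMk_add_left]

/-- The tensor product of morphisms in `Ind(C)` is biadditive. -/
instance indPreadditive : MonoidalPreadditive (Ind P).FullSubcategory :=
  have left : ∀ (X : (Ind P).FullSubcategory) {Y Z : (Ind P).FullSubcategory} (G G' : Y ⟶ Z),
      X ◁ (G + G') = X ◁ G + X ◁ G' := fun X _ _ G G' =>
    ind_ext (tensMap_add_right (𝟙 X.obj) G.hom G'.hom)
  have right : ∀ (X : (Ind P).FullSubcategory) {Y Z : (Ind P).FullSubcategory} (G G' : Y ⟶ Z),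
      (G + G') ▷ X = G ▷ X + G' ▷ X := fun X _ _ G G' =>
    ind_ext (tensMap_add_left G.hom G'.hom (𝟙 X.obj))
  { whiskerLeft_zero := fun {X Y Z} =>
      add_eq_left.1 ((left X (0 : Y ⟶ Z) 0).symm.trans (by rw [add_zero]))
    zero_whiskerRight := fun {X Y Z} =>
      add_eq_left.1 ((right X (0 : Y ⟶ Z) 0).symm.trans (by rw [add_zero]))
    whiskerLeft_add := left _
    add_whiskerRight := right _ }

variable [MonoidalLinear ℂ P.FullSubcategory]

lemma tensMk_smul_right {A B : P.FullSubcategory} (c : ℂ) (p : A.obj ⟶ X) (q : B.obj ⟶ Y) :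
    tensMk p (c • q) = c • tensMk p q := by
  have h : c • q = (c • toIm q).hom ≫ (im q).i := rfl
  have h' : tensMk p q = (A ◁ toIm q).hom ≫ tensMk p (im q).i := by rw [← tensMk_comp_right, toIm_i]
  rw [h, tensMk_comp_right, h', MonoidalLinear.whiskerLeft_smul]
  exact Linear.smul_comp _ _ _ _ _ _

lemma tensMk_smul_left {A B : P.FullSubcategory} (c : ℂ) (p : A.obj ⟶ X) (q : B.obj ⟶ Y) :
    tensMk (c • p) q = c • tensMk p q := by
  have h : c • p = (c • toIm p).hom ≫ (im p).i := rfl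
  have h' : tensMk p q = (toIm p ▷ B).hom ≫ tensMk (im p).i q := by rw [← tensMk_comp_left, toIm_i]
  rw [h, tensMk_comp_left, h', MonoidalLinear.smul_whiskerRight]
  exact Linear.smul_comp _ _ _ _ _ _

/-- The tensor product of morphisms in `Ind(C)` is bilinear. -/
instance indLinear : MonoidalLinear ℂ (Ind P).FullSubcategory where
  whiskerLeft_smul X _ _ c G := ind_ext (tensMk_ext fun A B p q => by
    have h := tensMk_map p q (𝟙 X.obj) G.hom
    have h' := tensMk_map p q (𝟙 X.obj) (c • G.hom)
    refine h'.trans ?_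
    rw [Linear.comp_smul, tensMk_smul_right, ← h]
    exact (Linear.comp_smul _ _ _ _ _ _).symm)
  smul_whiskerRight c _ _ G X := ind_ext (tensMk_ext fun A B p q => by
    have h := tensMk_map p q G.hom (𝟙 X.obj)
    have h' := tensMk_map p q (c • G.hom) (𝟙 X.obj)
    refine h'.trans ?_
    rw [Linear.comp_smul, tensMk_smul_left, ← h]
    exact (Linear.comp_smul _ _ _ _ _ _).symm)

end Linear

section Braided

variable [BraidedCategory P.FullSubcategory]

lemma braid_naturality {X' Y' : WeakModule V} (F : X ⟶ X') (G : Y ⟶ Y') :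
    tensMap F G ≫ (tensBraid P X' Y').hom = (tensBraid P X Y).hom ≫ tensMap G F :=
  tensMk_ext fun A B p q => by
    rw [tensMk_map_assoc, tensMk_braid, tensMk_braid_assoc, tensMk_map]

lemma braid_hexagon_forward :
    (tensAssoc P X Y Z).inv ≫ (tensBraid P X (tens P Y Z)).hom ≫ (tensAssoc P Y Z X).inv =
      tensMap (tensBraid P X Y).hom (𝟙 Z) ≫ (tensAssoc P Y X Z).inv ≫
        tensMap (𝟙 Y) (tensBraid P X Z).hom :=
  tensMk_ext_left fun A B D p q r => by
    have h := hom_congr (BraidedCategory.hexagon_forward A B D)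
    simp only [ObjectProperty.FullSubcategory.comp_hom] at h
    rw [tensMk_assoc_inv_assoc, tensMk_braid_assoc, tensMk_assoc_inv, tensMk_map_assoc, tensMk_braid,
      Category.comp_id, tensMk_comp_left, Category.assoc, tensMk_assoc_inv_assoc, tensMk_map,
      Category.comp_id, tensMk_braid, tensMk_comp_right]
    simp only [← Category.assoc] at h ⊢
    rw [h]

lemma tensMk_assoc_hom_assoc {A B D : P.FullSubcategory} (p : A.obj ⟶ X) (q : B.obj ⟶ Y)
    (r : D.obj ⟶ Z) (k : tens P (tens P X Y) Z ⟶ T) :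
    tensMk p (tensMk q r) ≫ (tensAssoc P X Y Z).hom ≫ k = (α_ A B D).inv.hom ≫ tensMk (tensMk p q) r ≫ k := by
  rw [← Category.assoc, tensMk_assoc_hom, Category.assoc]

lemma braid_hexagon_reverse :
    (tensAssoc P X Y Z).hom ≫ (tensBraid P (tens P X Y) Z).hom ≫ (tensAssoc P Z X Y).hom =
      tensMap (𝟙 X) (tensBraid P Y Z).hom ≫ (tensAssoc P X Z Y).hom ≫
        tensMap (tensBraid P X Z).hom (𝟙 Y) :=
  tensMk_ext_right fun A B D p q r => by
    have h := hom_congr (BraidedCategory.hexagon_reverse A B D)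
    simp only [ObjectProperty.FullSubcategory.comp_hom] at h
    rw [tensMk_assoc_hom_assoc, tensMk_braid_assoc, tensMk_assoc_hom, tensMk_map_assoc, tensMk_braid,
      Category.comp_id, tensMk_comp_right, Category.assoc, tensMk_assoc_hom_assoc, tensMk_map,
      Category.comp_id, tensMk_braid, tensMk_comp_left]
    simp only [← Category.assoc] at h ⊢
    rw [h]

/-- The braiding of `Ind(C)`. -/
instance indBraided : BraidedCategory (Ind P).FullSubcategory where
  braiding X Y := (Ind P).isoMk (tensBraid P X.obj Y.obj)
  braiding_naturality_right _ _ _ _ := ind_ext (braid_naturality _ _)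
  braiding_naturality_left _ _ := ind_ext (braid_naturality _ _)
  hexagon_forward _ _ _ := ind_ext braid_hexagon_forward
  hexagon_reverse _ _ _ := ind_ext braid_hexagon_reverse

variable (θ : Twist P.FullSubcategory)

/-- The automorphism of `lim α_X` induced by the twists of the `C`-submodules of `X`. -/
def thetaHat (X : WeakModule V) : lim (subSys (P := P) X) ≅ lim (subSys (P := P) X) where
  hom := subDesc (fun W => (θ.iso.hom.app W.toC).hom ≫ subφ W) (fun W U h => by
    rw [← map_subφ h, ← Category.assoc, ← Category.assoc]
    exact congrArg (· ≫ _) (hom_congr (θ.iso.hom.naturality (CSub.f h))))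
  inv := subDesc (fun W => (θ.iso.inv.app W.toC).hom ≫ subφ W) (fun W U h => by
    rw [← map_subφ h, ← Category.assoc, ← Category.assoc]
    exact congrArg (· ≫ _) (hom_congr (θ.iso.inv.naturality (CSub.f h))))
  hom_inv_id := sub_ext fun W => by
    rw [← Category.assoc, subφ_desc, Category.assoc, subφ_desc, ← Category.assoc,
      ← ObjectProperty.FullSubcategory.comp_hom, Iso.hom_inv_id_app]
    rfl
  inv_hom_id := sub_ext fun W => by
    rw [← Category.assoc, subφ_desc, Category.assoc, subφ_desc, ← Category.assoc,
      ← ObjectProperty.FullSubcategory.comp_hom, Iso.inv_hom_id_app]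
    rfl

lemma subφ_thetaHat {X : WeakModule V} (W : CSub P X) :
    subφ W ≫ (thetaHat θ X).hom = (θ.iso.hom.app W.toC).hom ≫ subφ W := by
  simp only [thetaHat]
  rw [subφ_desc]

/-- The twist `Θ_X = Q_X ∘ θ̂_X ∘ Q_X⁻¹` of an object of `Ind(C)`. -/
def indTheta (X : (Ind P).FullSubcategory) : X ≅ X :=
  (Ind P).isoMk (letI := subQ_isIso X.property
    (asIso (subQ X.obj)).symm ≪≫ thetaHat θ X.obj ≪≫ asIso (subQ X.obj))

lemma comp_indTheta (X : (Ind P).FullSubcategory) {A : P.FullSubcategory} (p : A.obj ⟶ X.obj) :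
    p ≫ (indTheta θ X).hom.hom = (θ.iso.hom.app A).hom ≫ p := by
  have := subQ_isIso X.property
  have h₁ : subφ (im p) ≫ subQ X.obj = (im p).i := subφ_Q _
  have h₂ : (im p).i ≫ inv (subQ X.obj) = subφ (im p) := by
    rw [← h₁, Category.assoc, IsIso.hom_inv_id, Category.comp_id]
  have h₃ : subφ (im p) ≫ (thetaHat θ X.obj).hom =
      (θ.iso.hom.app (im p).toC).hom ≫ subφ (im p) :=
    subφ_thetaHat θ (im p)
  have h₄ : p ≫ (indTheta θ X).hom.hom = (toIm p).hom ≫ (im p).i ≫ inv (subQ X.obj) ≫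
      (thetaHat θ X.obj).hom ≫ subQ X.obj := rfl
  have h₅ := hom_congr (θ.iso.hom.naturality (toIm p))
  simp only [Functor.id_map, Functor.id_obj, ObjectProperty.FullSubcategory.comp_hom] at h₅
  rw [h₄, ← Category.assoc (im p).i, h₂, ← Category.assoc (subφ _), h₃, Category.assoc, h₁,
    ← Category.assoc, h₅, Category.assoc, toIm_i]

lemma ind_hom_ext {X Y : (Ind P).FullSubcategory} {g h : X ⟶ Y}
    (e : ∀ (A : P.FullSubcategory) (p : A.obj ⟶ X.obj), p ≫ g.hom = p ≫ h.hom) : g = h := by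
  refine ind_ext (hom_ext fun x => ?_)
  obtain ⟨W, w, rfl⟩ := exists_mem X.property x
  exact lin_congr (e W.toC W.i) w

/-- The twist of `Ind(C)`. -/
def indTwist : Twist (Ind P).FullSubcategory where
  iso := NatIso.ofComponents (indTheta θ) (fun {X Y} F => ind_hom_ext fun A p => by
    have h₁ := comp_indTheta θ Y (p ≫ F.hom)
    have h₂ := comp_indTheta θ X p
    simp only [Functor.id_map, Functor.id_obj, ObjectProperty.FullSubcategory.comp_hom]
    rw [← Category.assoc, h₁, ← Category.assoc, ← Category.assoc, h₂])
  unit := ind_hom_ext fun A p => by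
    have h := comp_indTheta θ (𝟙_ (Ind P).FullSubcategory) (A := 𝟙_ _)
      (𝟙 (𝟙_ P.FullSubcategory).obj)
    rw [θ.unit] at h
    exact congrArg (p ≫ ·) h
  balancing X Y := ind_ext (tensMk_ext (X := X.obj) (Y := Y.obj) fun A B p q => by
    have h := comp_indTheta θ (X ⊗ Y) (A := A ⊗ B) (tensMk p q)
    rw [θ.balancing] at h
    refine h.trans ?_
    have h₁ : tensMk p q ≫ tensMap (indTheta θ X).hom.hom (indTheta θ Y).hom.hom ≫
        (tensBraid P X.obj Y.obj).hom ≫ (tensBraid P Y.obj X.obj).hom =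
        (θ.iso.hom.app A ⊗ₘ θ.iso.hom.app B).hom ≫ (β_ A B).hom.hom ≫
          (β_ B A).hom.hom ≫ tensMk p q := by
      rw [tensMk_map_assoc, comp_indTheta, comp_indTheta, tensMk_braid_assoc, tensMk_braid, ← comp_tensMk]
      have h₂ := hom_congr (BraidedCategory.braiding_naturality (θ.iso.hom.app A)
        (θ.iso.hom.app B))
      have h₃ := hom_congr (BraidedCategory.braiding_naturality (θ.iso.hom.app B)
        (θ.iso.hom.app A))
      simp only [ObjectProperty.FullSubcategory.comp_hom, Functor.id_obj] at h₂ h₃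
      simp only [← Category.assoc, Functor.id_obj]
      rw [h₂, Category.assoc _ _ (β_ B A).hom.hom, h₃]
      simp only [Category.assoc]
    refine Eq.trans ?_ h₁.symm
    simp only [ObjectProperty.FullSubcategory.comp_hom, Category.assoc])

end Braided

end Ind

/-! ### The embedding -/

variable (P) in
/-- The embedding of `C` into `Ind(C)`. -/
abbrev embedding : P.FullSubcategory ⥤ (Ind P).FullSubcategory := ObjectProperty.ιOfLE le_Ind

variable (P) in
/-- The property of objects of `Ind(C)` of being an object of `C`. -/
def inC : ObjectProperty (Ind P).FullSubcategory := fun X => P X.obj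

variable (P) in
/-- The functor from `C` to the full subcategory of `Ind(C)` on the objects of `C` through which
the embedding of `C` into `Ind(C)` factors. -/
abbrev toInC : P.FullSubcategory ⥤ (inC P).FullSubcategory :=
  (inC P).lift (embedding P) (fun W => W.property)

/-- The restriction of a twist to a full monoidal subcategory. -/
def Twist.restrict {C : Type*} [Category C] [MonoidalCategory C] [BraidedCategory C]
    (T : Twist C) (S : ObjectProperty C) [S.IsMonoidal] : Twist S.FullSubcategory where
  iso := NatIso.ofComponents (fun X => S.isoMk (T.iso.app X.obj))
    (fun F => S.hom_ext (T.iso.hom.naturality F.hom))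
  unit := S.hom_ext T.unit
  balancing X Y := S.hom_ext (T.balancing X.obj Y.obj)

/-- A functor `F` between categories with twist preserves the twists if `θ_{F(X)} = F(θ_X)`. -/
def PreservesTwist {C D : Type*} [Category C] [MonoidalCategory C] [BraidedCategory C]
    [Category D] [MonoidalCategory D] [BraidedCategory D] (F : C ⥤ D) (T : Twist C)
    (T' : Twist D) : Prop :=
  ∀ X : C, T'.iso.hom.app (F.obj X) = F.map (T.iso.hom.app X)

end VOA

end

open VOA

/-! An object $A$ of $\mathcal{C}$ is a $\mathcal{C}$-submodule of itself, so the directed set $I_A$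
has a greatest element. For $A, B$ in $\mathcal{C}$ the index set $I_A \times I_B$ then has a
greatest element too, and a direct limit over such a set is the value there. Hence $A
\widehat{\boxtimes} B$ is $A \boxtimes B$: the morphisms $i_U \boxtimes i_{U'}$ induce the
comparison map `tensQ`, and the canonical map at the greatest index inverts it.

The greatest submodule is only isomorphic to $A$, not equal to it as an object. The proofs therefore
avoid the canonical maps `tensφ` and work with the test morphisms `tensMk p q`, which exist for all
morphisms `p`, `q` out of objects of $\mathcal{C}$. Since $\mathcal{C}$ is full, test morphisms into
$A \widehat{\boxtimes} B$ come from morphisms of $\mathcal{C}$, and they separate morphisms out of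
it (`tensMk_hom_ext`). The key formula is `tensMk_tensQ`: the comparison map turns `tensMk a.hom
b.hom` into `a ⊗ₘ b`.

All compatibilities follow the same pattern. On test morphisms the structure maps of
$\mathrm{Ind}(\mathcal{C})$ are given by those of $\mathcal{C}$ (`tensMk_map`, `tensMk_leftHom`,
`tensMk_rightHom`, `tensMk_assoc_inv`, `tensMk_braid`). After `tensMk_tensQ` only functoriality of
$\boxtimes$ and naturality of $l$, $r$, $\mathcal{A}$, $\mathcal{R}$ remain. For associativity the
tests are the iterated `tensMk (tensMk p q) r`; that these suffice (`tensMk_ext_left`) rests on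
finite generation, by which a morphism from an object of $\mathcal{C}$ to a direct limit factors
through some stage.

The twist is determined by its restriction along morphisms from objects of $\mathcal{C}$
(`comp_indTheta`), and the identity of $A$ is one of these.

Finally, the isomorphisms $Q$ show that the objects of $\mathcal{C}$ are closed under
$\widehat{\boxtimes}$ inside $\mathrm{Ind}(\mathcal{C})$. The braided structure of the embedding
lifts to the full subcategory on them, because equations there are equations in
$\mathrm{Ind}(\mathcal{C})$. -/

namespace VOA

/-! ### The comparison isomorphisms $Q$ on objects of $\mathcal{C}$ -/

section

variable {V : Type u} [AddCommGroup V] [Module ℂ V] [VertexOperatorAlgebra V]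
  {P : ObjectProperty (WeakModule V)} [IsModuleSubcategory P] [MonoidalCategory P.FullSubcategory]

/-- The morphism `A ⊠̂ B ⟶ A ⊠ B` for objects `A` and `B` of `C` which restricts to
`i_U ⊠ i_U'` on `U ⊠ U'`. -/
noncomputable def tensQ (A B : P.FullSubcategory) : tens P A.obj B.obj ⟶ (A ⊗ B).obj :=
  tensDesc (fun U U' => ((ObjectProperty.homMk U.i : U.toC ⟶ A) ⊗ₘ
      (ObjectProperty.homMk U'.i : U'.toC ⟶ B)).hom)
    (fun W U W' U' h h' => by
      -- Functoriality of $\boxtimes$ reduces the compatibility to the fact that $W \subseteq U \to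
      -- A$ composes to the inclusion of $W$, which holds by definition.
      rw [← ObjectProperty.FullSubcategory.comp_hom, tensorHom_comp_tensorHom]
      rfl)

lemma tensφ_tensQ {A B : P.FullSubcategory} (U : CSub P A.obj) (U' : CSub P B.obj) :
    tensφ U U' ≫ tensQ A B = ((ObjectProperty.homMk U.i : U.toC ⟶ A) ⊗ₘ
      (ObjectProperty.homMk U'.i : U'.toC ⟶ B)).hom :=
  tensφ_desc _ _ _ _

/-- The test morphism passes through the images of `a` and `b`, and the comparison map then applies
the inclusions of these images. A morphism factored through its image is recovered by the inclusion,
so functoriality of $\boxtimes$ gives the result. No submodule is left in the formula, which makes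
it the rewriting rule for everything below. -/
lemma tensMk_tensQ {A B A' B' : P.FullSubcategory} (a : A' ⟶ A) (b : B' ⟶ B) :
    tensMk a.hom b.hom ≫ tensQ A B = (a ⊗ₘ b).hom := by
  rw [tensMk, Category.assoc, tensφ_tensQ, ← ObjectProperty.FullSubcategory.comp_hom,
    tensorHom_comp_tensorHom]
  rfl

/-- Morphisms out of `A ⊠̂ B` for objects `A` and `B` of `C` are determined by their composites
with the morphisms `A' ⊠ B' ⟶ A ⊠̂ B` induced by morphisms of `C`. -/
lemma tensMk_hom_ext {A B : P.FullSubcategory} {Z : WeakModule V} {g h : tens P A.obj B.obj ⟶ Z}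
    (e : ∀ {A' B' : P.FullSubcategory} (a : A' ⟶ A) (b : B' ⟶ B),
      tensMk a.hom b.hom ≫ g = tensMk a.hom b.hom ≫ h) : g = h :=
  tensMk_ext fun _ _ p q => e (ObjectProperty.homMk p) (ObjectProperty.homMk q)

/-- `A ⊠̂ B` is isomorphic to `A ⊠ B` for objects `A` and `B` of `C`. -/
noncomputable def tensQIso (A B : P.FullSubcategory) : tens P A.obj B.obj ≅ (A ⊗ B).obj where
  hom := tensQ A B
  -- The images of the identities are the greatest submodules, so this is the canonical map at the
  -- greatest index, up to $A \cong \mathrm{im}(\mathrm{Id}_A)$ and $B \cong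
  -- \mathrm{im}(\mathrm{Id}_B)$.
  inv := tensMk (𝟙 A.obj) (𝟙 B.obj)
  hom_inv_id := tensMk_hom_ext fun a b => by
    -- The comparison map yields `a ⊗ₘ b`, and `comp_tensMk` absorbs it into the inverse, which
    -- gives back the test morphism for `a` and `b`.
    rw [← Category.assoc, tensMk_tensQ, comp_tensMk, Category.comp_id, Category.comp_id,
      Category.comp_id]
  inv_hom_id := by
    refine (tensMk_tensQ (𝟙 A) (𝟙 B)).trans ?_
    rw [id_tensorHom_id]
    rfl

/-! ### Compatibility of $Q$ with morphisms, units, associativity and braiding -/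

lemma tensQ_naturality {A B A' B' : P.FullSubcategory} (a : A ⟶ A') (b : B ⟶ B') :
    tensMap a.hom b.hom ≫ tensQ A' B' = tensQ A B ≫ (a ⊗ₘ b).hom :=
  tensMk_hom_ext fun p q => by
    -- On the test morphism for `p` and `q` both sides become `(p ≫ a) ⊗ₘ (q ≫ b)`.
    rw [tensMk_map_assoc, ← ObjectProperty.FullSubcategory.comp_hom,
      ← ObjectProperty.FullSubcategory.comp_hom, tensMk_tensQ, ← Category.assoc, tensMk_tensQ,
      ← ObjectProperty.FullSubcategory.comp_hom, tensorHom_comp_tensorHom]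

/-- Restricted along the test morphism for `p` and `q`, the claim reads $q \circ l \circ (p
\boxtimes \mathrm{Id}) = l_A \circ (p \boxtimes q)$, which is naturality of $l$ with respect to `q`.
-/
lemma tensQ_leftHom (A : P.FullSubcategory) :
    leftHom P A.obj = tensQ (𝟙_ _) A ≫ (λ_ A).hom.hom :=
  tensMk_hom_ext fun p q => by
    rw [tensMk_leftHom, ← Category.assoc (tensMk _ _), tensMk_tensQ]
    simp only [← ObjectProperty.FullSubcategory.comp_hom]
    refine hom_congr ?_
    rw [MonoidalCategory.tensorHom_def, Category.assoc, leftUnitor_naturality]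

lemma tensQ_rightHom (A : P.FullSubcategory) :
    rightHom P A.obj = tensQ A (𝟙_ _) ≫ (ρ_ A).hom.hom :=
  tensMk_hom_ext fun p q => by
    rw [tensMk_rightHom, ← Category.assoc (tensMk _ _), tensMk_tensQ]
    simp only [← ObjectProperty.FullSubcategory.comp_hom]
    refine hom_congr ?_
    -- The morphism into the unit has to be applied first. It is now the second tensor factor, hence
    -- `tensorHom_def'` in place of `tensorHom_def`.
    rw [tensorHom_def', Category.assoc, rightUnitor_naturality]

/-- Mathlib's associators are the inverses of $\mathcal{A}$ and $\mathfrak{A}$, so the usual hexagon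
for $\mathcal{A}$ and $\mathfrak{A}$ follows by composing with these on the two outer sides. On
iterated test morphisms both paths collapse to the naturality square of the associator of
$\mathcal{C}$ at `a`, `b`, `d`. -/
lemma tensQ_assoc (A B D : P.FullSubcategory) :
    tensMap (tensQ A B) (𝟙 D.obj) ≫ tensQ (A ⊗ B) D ≫ (α_ A B D).hom.hom =
      (tensAssoc P A.obj B.obj D.obj).inv ≫ tensMap (𝟙 A.obj) (tensQ B D) ≫ tensQ A (B ⊗ D) :=
  tensMk_ext_left fun A' B' D' p q r => by
    -- By fullness the three tests are underlying maps of morphisms of $\mathcal{C}$; in this form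
    -- `tensMk_tensQ` can rewrite the nested `tensMk`.
    obtain ⟨a, rfl⟩ : ∃ a : A' ⟶ A, a.hom = p := ⟨ObjectProperty.homMk p, rfl⟩
    obtain ⟨b, rfl⟩ : ∃ b : B' ⟶ B, b.hom = q := ⟨ObjectProperty.homMk q, rfl⟩
    obtain ⟨d, rfl⟩ : ∃ d : D' ⟶ D, d.hom = r := ⟨ObjectProperty.homMk r, rfl⟩
    rw [tensMk_map_assoc, tensMk_assoc_inv_assoc, tensMk_map_assoc, tensMk_tensQ, tensMk_tensQ,
      Category.comp_id, Category.comp_id, tensMk_tensQ, ← Category.assoc, tensMk_tensQ,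
      ← ObjectProperty.FullSubcategory.comp_hom, ← ObjectProperty.FullSubcategory.comp_hom,
      associator_naturality]

/-- On test morphisms this is naturality of $\mathcal{R}$ in both variables. -/
lemma tensQ_braid [BraidedCategory P.FullSubcategory] (A B : P.FullSubcategory) :
    tensQ A B ≫ (β_ A B).hom.hom = (tensBraid P A.obj B.obj).hom ≫ tensQ B A :=
  tensMk_hom_ext fun p q => by
    rw [tensMk_braid_assoc, ← Category.assoc, tensMk_tensQ, tensMk_tensQ,
      ← ObjectProperty.FullSubcategory.comp_hom, ← ObjectProperty.FullSubcategory.comp_hom,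
      BraidedCategory.braiding_naturality]

/-! ### The embedding as a braided functor which preserves the twists -/

variable (P) in
/-- The monoidal structure of the embedding of `C` into `Ind(C)`, given by the isomorphisms
`A ⊠̂ B ≅ A ⊠ B` and the identity of the unit object. -/
noncomputable abbrev embeddingCoreMonoidal : (embedding P).CoreMonoidal where
  -- The unit of $\mathrm{Ind}(\mathcal{C})$ is by construction the module underlying the unit of
  -- $\mathcal{C}$, so the identity makes sense here.
  εIso := (Ind P).isoMk (Iso.refl (unit P))
  μIso A B := (Ind P).isoMk (tensQIso A B)
  -- A monoidal functor asks for naturality in each variable separately; the other variable is held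
  -- fixed by an identity.
  μIso_hom_natural_left f A := ind_ext ((tensQ_naturality f (𝟙 A)).trans
    (by rw [tensorHom_id]; rfl))
  μIso_hom_natural_right A f := ind_ext ((tensQ_naturality (𝟙 A) f).trans
    (by rw [id_tensorHom]; rfl))
  associativity A B D := ind_ext (tensQ_assoc A B D)
  left_unitality A := ind_ext (by
    -- The unit comparison, whiskered with $A$, is a tensor product of two identities and
    -- disappears.
    change leftHom P A.obj = tensMap (𝟙 _) (𝟙 _) ≫ tensQ (𝟙_ _) A ≫ (λ_ A).hom.hom
    rw [tensMap_id, Category.id_comp, tensQ_leftHom])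
  right_unitality A := ind_ext (by
    change rightHom P A.obj = tensMap (𝟙 _) (𝟙 _) ≫ tensQ A (𝟙_ _) ≫ (ρ_ A).hom.hom
    rw [tensMap_id, Category.id_comp, tensQ_rightHom])

variable (P) in
/-- The embedding of `C` into `Ind(C)` as a braided functor. -/
noncomputable abbrev embeddingBraided [BraidedCategory P.FullSubcategory] : (embedding P).Braided where
  toMonoidal := (embeddingCoreMonoidal P).toMonoidal
  braided A B := ind_ext (tensQ_braid A B)

/-- By `comp_indTheta`, $\Theta_X \circ p = p \circ \theta_A$ for every `p` from an object $A$ of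
$\mathcal{C}$ to $X$. When $X$ is $A$ itself, `p` can be the identity. -/
lemma embedding_preservesTwist [BraidedCategory P.FullSubcategory] (θ : Twist P.FullSubcategory) :
    PreservesTwist (embedding P) θ (indTwist θ) := fun A =>
  ind_ext ((Category.id_comp _).symm.trans
    ((comp_indTheta θ ((embedding P).obj A) (A := A) (𝟙 A.obj)).trans (Category.comp_id _)))

/-! ### The full subcategory of $\mathrm{Ind}(\mathcal{C})$ on the objects of $\mathcal{C}$ -/

/-- Tensor products in `Ind(C)` of objects of `C` are objects of `C`. -/
lemma inC_isMonoidal : (inC P).IsMonoidal where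
  prop_unit := (𝟙_ P.FullSubcategory).property
  prop_tensor X Y hX hY :=
    -- Closure of $\mathcal{C}$ under isomorphisms is a case of closure under submodules, since an
    -- isomorphism is injective.
    let e := tensQIso (P := P) ⟨X.obj, hX⟩ ⟨Y.obj, hY⟩
    IsModuleSubcategory.submodule e.hom
      (Function.LeftInverse.injective (g := WeakModule.lin e.inv)
        fun z => lin_congr e.hom_inv_id z)
      ((⟨X.obj, hX⟩ : P.FullSubcategory) ⊗ ⟨Y.obj, hY⟩).property

/-- Source and target are full in the category of weak modules, so they have the same morphisms, and
an object of the target is an object of $\mathcal{C}$ with its membership proofs rearranged.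
Essential surjectivity is therefore witnessed by identities. -/
instance : (toInC P).IsEquivalence where
  faithful := ⟨fun h => P.hom_ext (congrArg (fun g => g.hom.hom) h)⟩
  full := ⟨fun g => ⟨ObjectProperty.homMk g.hom.hom, rfl⟩⟩
  essSurj := ⟨fun X => ⟨⟨X.obj.obj, X.property⟩, ⟨Iso.refl X⟩⟩⟩

end

/-! ### Lifting braided functors to full monoidal subcategories of the target -/

section Lift

open Functor.LaxMonoidal

variable {C D : Type*} [Category C] [MonoidalCategory C] [Category D] [MonoidalCategory D]
  (S : ObjectProperty D) [S.IsMonoidal] (F : C ⥤ D) (hF : ∀ X, S (F.obj X))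

/-- The lift of a monoidal functor to a full monoidal subcategory of its target. -/
abbrev liftCoreMonoidal [F.Monoidal] : (S.lift F hF).CoreMonoidal where
  εIso := S.isoMk (Functor.Monoidal.εIso F)
  μIso X Y := S.isoMk (Functor.Monoidal.μIso F X Y)
  -- Tensor product and structure isomorphisms of the full subcategory are those of `D`, so each
  -- axiom is the one for `F`, read in `D`.
  μIso_hom_natural_left f X := S.hom_ext (μ_natural_left F f X)
  μIso_hom_natural_right X f := S.hom_ext (μ_natural_right F X f)
  associativity X Y Z := S.hom_ext (associativity F X Y Z)
  left_unitality X := S.hom_ext (left_unitality F X)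
  right_unitality X := S.hom_ext (right_unitality F X)

/-- The lift of a braided functor to a full monoidal subcategory of its target. -/
abbrev liftBraided [BraidedCategory C] [BraidedCategory D] [F.Braided] :
    (S.lift F hF).Braided where
  toMonoidal := (liftCoreMonoidal S F hF).toMonoidal
  braided X Y := S.hom_ext (Functor.LaxBraided.braided X Y)

end Lift

end VOA

/-- Naturality of $Q$ and the four compatibility equations are the axioms of `Functor.Braided`.
Prescribing `ε` and `μ` ties the braided structures whose existence is claimed to $\mathrm{Id}_V$
and to this same $Q$, for the embedding and for the equivalence alike. -/
theorem theorem5p3 {V : Type u} [AddCommGroup V] [Module ℂ V] [VertexOperatorAlgebra V]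
    (P : ObjectProperty (WeakModule V)) [IsModuleSubcategory P]
    [MonoidalCategory P.FullSubcategory] [BraidedCategory P.FullSubcategory]
    [MonoidalPreadditive P.FullSubcategory] [MonoidalLinear ℂ P.FullSubcategory]
    (hV : (𝟙_ P.FullSubcategory).obj = WeakModule.self V)
    (θ : Twist P.FullSubcategory) :
    -- the natural isomorphisms `Q_{W₁,W₂} : W₁ ⊠̂ W₂ ⟶ W₁ ⊠ W₂`
    ∃ Q : ∀ W₁ W₂ : P.FullSubcategory,
        (embedding P).obj W₁ ⊗ (embedding P).obj W₂ ≅ (embedding P).obj (W₁ ⊗ W₂),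
      (∀ (W₁ W₂ : P.FullSubcategory) (U₁ : CSub P W₁.obj) (U₂ : CSub P W₂.obj),
        tensφ U₁ U₂ ≫ (Q W₁ W₂).hom.hom =
          ((ObjectProperty.homMk U₁.i : U₁.toC ⟶ W₁) ⊗ₘ
            (ObjectProperty.homMk U₂.i : U₂.toC ⟶ W₂)).hom) ∧
      -- the embedding, with `Q` and the identity of `V`, is a fully faithful `ℂ`-linear braided
      -- tensor functor which preserves the twists
      (embedding P).Full ∧ (embedding P).Faithful ∧
      (embedding P).Additive ∧ (embedding P).Linear ℂ ∧
      (∃ _ : (embedding P).Braided,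
        (Functor.LaxMonoidal.ε (embedding P)).hom = 𝟙 (𝟙_ P.FullSubcategory).obj ∧
        ∀ W₁ W₂, Functor.LaxMonoidal.μ (embedding P) W₁ W₂ = (Q W₁ W₂).hom) ∧
      PreservesTwist (embedding P) θ (indTwist θ) ∧
      -- the objects of `C` form a monoidal subcategory of `Ind(C)`, and the restriction of the
      -- structure of `Ind(C)` to it is equivalent to the original structure
      ∃ (_ : (inC P).IsMonoidal),
        (toInC P).IsEquivalence ∧ (toInC P).Additive ∧ (toInC P).Linear ℂ ∧
        (∃ _ : (toInC P).Braided,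
          (Functor.LaxMonoidal.ε (toInC P)).hom.hom = 𝟙 (𝟙_ P.FullSubcategory).obj ∧
          ∀ W₁ W₂, (Functor.LaxMonoidal.μ (toInC P) W₁ W₂).hom = (Q W₁ W₂).hom) ∧
        PreservesTwist (toInC P) θ ((indTwist θ).restrict (inC P)) := by
  -- Kept as data, because the lifted braided structure is built from it and the equation between
  -- its `μ` and $Q$ is checked by unfolding.
  let := embeddingBraided P
  have := inC_isMonoidal (P := P)
  -- Sums and scalar multiples of morphisms are those of underlying linear maps in all the
  -- categories involved, so additivity and linearity hold by definition.
  refine ⟨fun A B => (Ind P).isoMk (tensQIso A B), fun _ _ => tensφ_tensQ, inferInstance,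
    inferInstance, ⟨rfl⟩, ⟨fun _ _ => rfl⟩, ⟨embeddingBraided P, rfl, fun _ _ => rfl⟩,
    embedding_preservesTwist θ, inC_isMonoidal, inferInstance, ⟨rfl⟩, ⟨fun _ _ => rfl⟩,
    ⟨liftBraided (inC P) (embedding P) (fun W => W.property), rfl, fun _ _ => rfl⟩,
    -- The restricted twist has the same components as the twist of $\mathrm{Ind}(\mathcal{C})$, so
    -- the statement for the embedding suffices.
    fun A => (inC P).hom_ext (embedding_preservesTwist θ A)⟩
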